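/- Let $k$ be a field and $\Omega$ an algebraically closed field containing $k$. Let $k^{\mathrm{sep}}\subset k^{\mathrm{al}}\subset\Omega$ be the separable closure and the algebraic closure of $k$ in $\Omega$. An *algebraic scheme* over a field $F$ is a separated scheme of finite type over $\operatorname{Spec}F$; it is *quasi-projective* if it admits an immersion over $F$ into some $\mathbb P^n_F$. For a homomorphism of fields $i\colon F\to L$ and a scheme $V$ over $F$, put $iV=V\times_{\operatorname{Spec}F}\operatorname{Spec}L$, and let $i\varphi$ denote the base change of a morphism $\varphi$ of $F$-schemes; we identify $j(iV)$ with $(j\circ i)V$. When $L/F$ is a given extension, we write $V_L$ for $iV$ with $i$ the inclusion. Let $K$ be a finite separable extension of $k$, and let $I$ be the set of $k$-homomorphisms $K\to\Omega$ (these take values in $k^{\mathrm{sep}}$). Let $V$ be a quasi-projective algebraic scheme over $K$, and for each pair $(\sigma,\tau)$ of elements of $I$ let $\phi_{\tau,\sigma}\colon\sigma V\to\tau V$ be an isomorphism of schemes over $\Omega$. Then there exist an algebraic scheme $V_0$ over $k$ and an isomorphism $\phi\colon V_{0K}\to V$ of schemes over $K$ such that $$\phi_{\tau,\sigma}=\tau\phi\circ(\sigma\phi)^{-1}\qquad\text{for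 all }\sigma,\tau\in I \tag{$*$}$$ (where $\sigma(V_{0K})$ and $\tau(V_{0K})$ are both identified with $V_{0\Omega}$) if and only if every $\phi_{\tau,\sigma}$ is defined over $k^{\mathrm{sep}}$ (i.e. is the base change of an isomorphism $\sigma V\to\tau V$ over $k^{\mathrm{sep}}$, with $\sigma,\tau$ regarded as maps $K\to k^{\mathrm{sep}}$) and the following two conditions hold: (a) $\phi_{\tau,\rho}=\phi_{\tau,\sigma}\circ\phi_{\sigma,\rho}$ for all $\rho,\sigma,\tau\in I$; (b) $\phi_{\omega\tau,\omega\sigma}=\omega\phi_{\tau,\sigma}$ for all $\sigma,\tau\in I$ and all $k$-automorphisms $\omega$ of $k^{\mathrm{al}}$. Here $\omega\sigma\in I$ is $x\mapsto\omega(\sigma(x))$, and $\omega\phi_{\tau,\sigma}\colon(\omega\sigma)V\to(\omega\tau)V$ is obtained by descending $\phi_{\tau,\sigma}$ to an isomorphism over $k^{\mathrm{al}}$, applying $\omega$, and extending the result to $\Omega$. Moreover, when this is so, the pair $(V_0,\phi)$ is unique up to a unique isomorphism over $k$: if $(V_0,\phi)$ and $(V_0',\phi')$ both satisfy $(*)$,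 there is exactly one isomorphism $\alpha\colon V_0\to V_0'$ of $k$-schemes with $\phi'\circ\alpha_K=\phi$. Furthermore $V_0$ is quasi-projective, and $V_0$ is quasi-affine if $V$ is. -/

import Mathlib

open CategoryTheory CategoryTheory.Limits AlgebraicGeometry

universe v w u

noncomputable section

namespace WeilDescent

/-- Schemes over (the spectrum of) a field `F`; the morphisms are the `F`-morphisms. -/
abbrev SchOver (F : Type u) [Field F] := Over (Spec (CommRingCat.of F))

/-- An algebraic scheme over `F`: separated and of finite type over `Spec F`. -/
structure IsAlgebraicScheme {F : Type u} [Field F] (V : SchOver F) : Prop where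
  isSeparated : IsSeparated V.hom
  locallyOfFiniteType : LocallyOfFiniteType V.hom
  quasiCompact : QuasiCompact V.hom

section Projective

attribute [local instance] MvPolynomial.gradedAlgebra

/-- Projective `n`-space `Proj F[X₀, …, Xₙ]` over `F`, with its structure morphism. -/
def projectiveSpace (F : Type u) [Field F] (n : ℕ) : SchOver F :=
  Over.mk (Y := Proj (MvPolynomial.homogeneousSubmodule (Fin (n + 1)) F))
    (Proj.toSpecZero (MvPolynomial.homogeneousSubmodule (Fin (n + 1)) F) ≫
      Spec.map (CommRingCat.ofHom
        (algebraMap F (MvPolynomial.homogeneousSubmodule (Fin (n + 1)) F 0))))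

end Projective

/-- A quasi-projective algebraic scheme over `F`: an algebraic scheme that admits an
`F`-immersion (that is, an isomorphism onto a locally closed subscheme) into some `ℙⁿ`. -/
def IsQuasiProjective {F : Type u} [Field F] (V : SchOver F) : Prop :=
  IsAlgebraicScheme V ∧ ∃ (n : ℕ) (e : V ⟶ projectiveSpace F n), IsImmersion e.left

/-- The canonical isomorphism `X ×_Z Y' ≅ (X ×_Z Y) ×_Y Y'`, for morphisms `Y' ⟶ Y ⟶ Z` with
composite `h`. -/
def pullbackTrans {C : Type w} [Category.{v} C] [HasPullbacks C] {X Y Y' Z : C}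
    (f : X ⟶ Z) (g : Y ⟶ Z) (g' : Y' ⟶ Y) (h : Y' ⟶ Z) (e : h = g' ≫ g) :
    pullback f h ≅ pullback (pullback.snd f g) g' where
  hom := pullback.lift
    (pullback.lift (pullback.fst f h) (pullback.snd f h ≫ g')
      (by rw [pullback.condition, Category.assoc, ← e]))
    (pullback.snd f h) (pullback.lift_snd _ _ _)
  inv := pullback.lift
    (pullback.fst (pullback.snd f g) g' ≫ pullback.fst f g)
    (pullback.snd (pullback.snd f g) g')
    (by rw [e, Category.assoc, pullback.condition, pullback.condition_assoc])
  hom_inv_id := by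
    apply pullback.hom_ext <;>
      simp only [Category.assoc, Category.id_comp, pullback.lift_fst, pullback.lift_snd,
        pullback.lift_fst_assoc]
  inv_hom_id := by
    apply pullback.hom_ext
    · apply pullback.hom_ext <;>
        simp only [Category.assoc, Category.id_comp, pullback.lift_fst, pullback.lift_snd,
          pullback.lift_snd_assoc, pullback.condition]
    · simp only [Category.assoc, Category.id_comp, pullback.lift_snd]

section BaseChange

variable {F L M : Type u} [Field F] [Field L] [Field M]

/-- For a homomorphism of fields `i : F → L`, the functor `V ↦ iV = V ×_{Spec F} Spec L`
(and `φ ↦ iφ` on morphisms). -/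
abbrev baseChange (i : F →+* L) : SchOver F ⥤ SchOver L :=
  Over.pullback (Spec.map (CommRingCat.ofHom i))

/-- The canonical isomorphism `(j ∘ i)V ≅ j(iV)`, compatible with the projections to `V`
and to the base. The composite `j ∘ i` may be given as any `l` with `l = j ∘ i`. -/
def baseChangeComp (i : F →+* L) (j : L →+* M) (l : F →+* M) (h : l = j.comp i)
    (V : SchOver F) :
    (baseChange l).obj V ≅ (baseChange j).obj ((baseChange i).obj V) :=
  Over.isoMk
    (pullbackTrans V.hom (Spec.map (CommRingCat.ofHom i)) (Spec.map (CommRingCat.ofHom j))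
      (Spec.map (CommRingCat.ofHom l)) (by rw [h, CommRingCat.ofHom_comp, Spec.map_comp]))
    (pullback.lift_snd _ _ _)

/-- If `ψ : iV ≅ i'V` is an isomorphism of schemes over `L` and `j : L → M` is a homomorphism
of fields, this is the isomorphism `jψ : (j ∘ i)V ≅ (j ∘ i')V`, i.e. the base change
`j(iV) ≅ j(i'V)` of `ψ` along `j`, read through the canonical identifications
`(j ∘ i)V = j(iV)` and `(j ∘ i')V = j(i'V)`. -/
def conjIso {V : SchOver F} {i i' : F →+* L} (j : L →+* M)
    (ψ : (baseChange i).obj V ≅ (baseChange i').obj V)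
    (l l' : F →+* M) (hl : l = j.comp i) (hl' : l' = j.comp i') :
    (baseChange l).obj V ≅ (baseChange l').obj V :=
  baseChangeComp i j l hl V ≪≫ (baseChange j).mapIso ψ ≪≫ (baseChangeComp i' j l' hl' V).symm

end BaseChange

section Embeddings

variable {k K Ω : Type u} [Field k] [Field K] [Field Ω] [Algebra k K] [Algebra k Ω]

/-- `σV`, for a `k`-homomorphism `σ : K → Ω`. -/
abbrev twist (σ : K →ₐ[k] Ω) (V : SchOver K) : SchOver Ω :=
  (baseChange (σ : K →+* Ω)).obj V

/-- A `k`-homomorphism from a separable extension `K` of `k` to `Ω`, regarded as a homomorphism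
to the separable closure of `k` in `Ω`. -/
def toSep [Algebra.IsSeparable k K] (σ : K →ₐ[k] Ω) : K →ₐ[k] separableClosure k Ω :=
  σ.codRestrict (separableClosure k Ω).toSubalgebra fun x =>
    mem_separableClosure_iff.2 <| by
      simpa only [IsSeparable, minpoly.algHom_eq σ σ.injective] using
        Algebra.IsSeparable.isSeparable k x

/-- A `k`-homomorphism from an algebraic extension `K` of `k` to `Ω`, regarded as a homomorphism
to the algebraic closure of `k` in `Ω`. -/
def toAl [Algebra.IsAlgebraic k K] (σ : K →ₐ[k] Ω) : K →ₐ[k] algebraicClosure k Ω :=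
  σ.codRestrict (algebraicClosure k Ω).toSubalgebra fun x =>
    mem_algebraicClosure_iff.2 (IsAlgebraic.algHom σ (Algebra.IsAlgebraic.isAlgebraic x))

/-- The `k`-homomorphism `x ↦ ω (σ x)`, for `ω` a `k`-automorphism of the algebraic closure of
`k` in `Ω`. -/
def galAct [Algebra.IsAlgebraic k K]
    (ω : algebraicClosure k Ω ≃ₐ[k] algebraicClosure k Ω) (σ : K →ₐ[k] Ω) : K →ₐ[k] Ω :=
  (algebraicClosure k Ω).val.comp ((ω : algebraicClosure k Ω →ₐ[k] _).comp (toAl σ))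

/-- An isomorphism `φ : σV ≅ τV` over `Ω` is defined over the separable closure `kˢ` of `k` in
`Ω` if it is the extension to `Ω` of an isomorphism `σV ≅ τV` over `kˢ`, where `σ` and `τ` are
now regarded as homomorphisms `K → kˢ`. -/
def IsDefinedOverSep [Algebra.IsSeparable k K] {V : SchOver K} {σ τ : K →ₐ[k] Ω}
    (φ : twist σ V ≅ twist τ V) : Prop :=
  ∃ ψ : (baseChange (toSep σ : K →+* separableClosure k Ω)).obj V ≅
      (baseChange (toSep τ : K →+* separableClosure k Ω)).obj V,
    φ = conjIso (algebraMap (separableClosure k Ω) Ω) ψ σ τ rfl rfl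

/-- `φ' = ωφ`, for an isomorphism `φ : σV ≅ τV` over `Ω` and a `k`-automorphism `ω` of the
algebraic closure `kᵃ` of `k` in `Ω`: there is an isomorphism `ψ : σV ≅ τV` over `kᵃ` whose
extension to `Ω` is `φ`, and the extension to `Ω` of `ωψ : (ωσ)V ≅ (ωτ)V` is `φ'`. -/
def IsGalConj [Algebra.IsAlgebraic k K] {V : SchOver K}
    (ω : algebraicClosure k Ω ≃ₐ[k] algebraicClosure k Ω) {σ τ : K →ₐ[k] Ω}
    (φ : twist σ V ≅ twist τ V) (φ' : twist (galAct ω σ) V ≅ twist (galAct ω τ) V) : Prop :=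
  ∃ ψ : (baseChange (toAl σ : K →+* algebraicClosure k Ω)).obj V ≅
      (baseChange (toAl τ : K →+* algebraicClosure k Ω)).obj V,
    φ = conjIso (algebraMap (algebraicClosure k Ω) Ω) ψ σ τ rfl rfl ∧
    φ' = conjIso (algebraMap (algebraicClosure k Ω) Ω)
      (conjIso (ω : algebraicClosure k Ω →+* algebraicClosure k Ω) ψ _ _ rfl rfl)
      (galAct ω σ) (galAct ω τ) rfl rfl

/-- The canonical isomorphism `(V₀)_Ω ≅ σ((V₀)_K)`, for a scheme `V₀` over `k`. -/
def twistBaseChange (σ : K →ₐ[k] Ω) (V₀ : SchOver k) :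
    (baseChange (algebraMap k Ω)).obj V₀ ≅ twist σ ((baseChange (algebraMap k K)).obj V₀) :=
  baseChangeComp (algebraMap k K) (σ : K →+* Ω) (algebraMap k Ω) σ.comp_algebraMap.symm V₀

/-- The pair `(V₀, f)`, with `V₀` an algebraic scheme over `k` and `f : (V₀)_K ≅ V`, gives rise
to the family `φ`: for all `σ, τ` one has `φ_{τ,σ} = τf ∘ (σf)⁻¹`, where `σ((V₀)_K)` and
`τ((V₀)_K)` are both identified with `(V₀)_Ω`. -/
structure IsModel {V : SchOver K} (φ : ∀ τ σ : K →ₐ[k] Ω, twist σ V ≅ twist τ V)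
    (V₀ : SchOver k) (f : (baseChange (algebraMap k K)).obj V₀ ≅ V) : Prop where
  isAlgebraic : IsAlgebraicScheme V₀
  eq : ∀ τ σ : K →ₐ[k] Ω, φ τ σ =
    ((baseChange (σ : K →+* Ω)).mapIso f).symm ≪≫ (twistBaseChange σ V₀).symm ≪≫
      twistBaseChange τ V₀ ≪≫ (baseChange (τ : K →+* Ω)).mapIso f

end Embeddings

end WeilDescent

end

open WeilDescent

/-! Necessity is formal: a model turns each `φ τ σ` into the unique isomorphism compatible with the
projections `σV → V → V₀` and `τV → V → V₀`, and such isomorphisms compose and base-change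
correctly. The content is sufficiency.

Write `S` for the separable closure, fix `σ₀ : K → S` and put `X = σ₀V` over `S`. The given
isomorphisms descend to `S`, uniquely because base change of fields is faithful, so the cocycle and
Galois conditions hold there too. They produce projections `p τ : X → V`, one for each embedding
`τ`, and semilinear maps `a ω : X → X` with `a ω ≫ p τ = p (ωτ)`.

Embed `V` in `ℙⁿ_K` and let `w_τ` be homogeneous coordinates of the point `p τ (x)`. With a basis
`a_i` of `K / k`, the coefficients of the norm form `∏_τ ∑_{i,j} τ(a_i) w_{τ,j} X_{i,j}` are
multilinear in the `w_τ` and equivariant under the Galois group. Hence they define an invariant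
morphism `X → ℙᴺ_k`. By independence of characters they span over `S` all products `∏_τ w_{τ,m(τ)}`,
the Segre coordinates of the tuple of conjugates, so the induced morphism `X → ℙᴺ_S` is an immersion
(`IsInvariantMap.isImmersion`). Its image is a Galois-stable locally closed subscheme and descends
to a subscheme `V₀` of `ℙᴺ_k` (`exists_isPullback_of_isImmersion`). The projection `X → V₀` then
factors through `V` by Galois descent from `S` to `K`, and the resulting square is cartesian by fpqc
descent (`exists_isPullback_of_isQuasiProjective`).

As `S / k` may be infinite, the descent rests on the graphs of the maps `a ω`. Because `S / k` is
weakly étale and normal, these graphs form a flat surjective family over `X ×_k S`, so they detect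
equality of morphisms and vanishing of ideals.

For uniqueness, the projection of `X` to one model is invariant for the action defined by another,
so it factors (`IsModel.exists_modelProj_fac`). Quasi-projectivity of an arbitrary model follows by
comparison with the constructed one, and quasi-affineness by descending the open immersion `V → Spec
Γ(V)`. -/

noncomputable section

namespace WeilDescent

section

/-! ### Separable algebraic extensions are weakly étale. -/

section WeaklyEtale

open TensorProduct

/-- Every element of the kernel of the multiplication `S ⊗ S → S` is killed by an element outside
of that kernel, when `S / F` is separable algebraic. -/
lemma exists_mul_eq_zero_of_lmul'_eq_zero {F S : Type u} [Field F] [Field S] [Algebra F S]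
    [Algebra.IsSeparable F S] (x : S ⊗[F] S) (hx : Algebra.TensorProduct.lmul' F x = 0) :
    ∃ m : S ⊗[F] S, Algebra.TensorProduct.lmul' F m ≠ 0 ∧ m * x = 0 := by
  have hx' : x ∈ KaehlerDifferential.ideal F S := hx
  rw [← KaehlerDifferential.span_range_eq_ideal] at hx'
  clear hx
  induction hx' using Submodule.span_induction with
  | mem x h =>
    obtain ⟨s, rfl⟩ := h
    -- Taylor expansion of the minimal polynomial at `s ⊗ 1` with increment `1 ⊗ s - s ⊗ 1`: both
    -- values vanish, so the increment is killed by `f'(s ⊗ 1)` plus a multiple of itself. The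
    -- multiplication map sends this factor to `f'(s)`, nonzero by separability.
    obtain ⟨q, hq⟩ := Polynomial.binomExpansion
      ((minpoly F s).map (algebraMap F (S ⊗[F] S))) (s ⊗ₜ[F] 1) (1 ⊗ₜ[F] s - s ⊗ₜ[F] 1)
    have h1 : ((minpoly F s).map (algebraMap F (S ⊗[F] S))).eval (s ⊗ₜ[F] 1) = 0 := by
      rw [Polynomial.eval_map_algebraMap]
      have := Polynomial.aeval_algHom_apply
        (Algebra.TensorProduct.includeLeft : S →ₐ[F] S ⊗[F] S) s (minpoly F s)
      simpa using this
    have h2 : ((minpoly F s).map (algebraMap F (S ⊗[F] S))).eval (1 ⊗ₜ[F] s) = 0 := by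
      rw [Polynomial.eval_map_algebraMap]
      have := Polynomial.aeval_algHom_apply
        (Algebra.TensorProduct.includeRight : S →ₐ[F] S ⊗[F] S) s (minpoly F s)
      simpa using this
    rw [add_sub_cancel, h1, h2, zero_add] at hq
    refine ⟨((minpoly F s).map (algebraMap F (S ⊗[F] S))).derivative.eval (s ⊗ₜ[F] 1) +
      q * (1 ⊗ₜ[F] s - s ⊗ₜ[F] 1), ?_, by rw [add_mul, mul_assoc, ← sq, ← hq]⟩
    have h3 : Algebra.TensorProduct.lmul' F
        (((minpoly F s).map (algebraMap F (S ⊗[F] S))).derivative.eval (s ⊗ₜ[F] 1)) =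
        Polynomial.aeval s (minpoly F s).derivative := by
      rw [Polynomial.derivative_map, Polynomial.eval_map_algebraMap,
        ← Polynomial.aeval_algHom_apply]
      simp
    rw [map_add, h3, map_mul, map_sub]
    simpa using (Algebra.IsSeparable.isSeparable F s).aeval_derivative_ne_zero
      (minpoly.aeval F s)
  | zero => exact ⟨1, by simp, by simp⟩
  | add x y _ _ hx hy =>
    obtain ⟨m, hm, hmx⟩ := hx
    obtain ⟨n, hn, hny⟩ := hy
    refine ⟨m * n, by rw [map_mul]; exact mul_ne_zero hm hn, ?_⟩
    linear_combination n * hmx + m * hny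
  | smul a x _ hx =>
    obtain ⟨m, hm, hmx⟩ := hx
    exact ⟨m, hm, by rw [smul_eq_mul, mul_left_comm, hmx, mul_zero]⟩

/-- Since every element of the kernel is killed by something outside it, the multiplication map is
the localization of `S ⊗ S` at the complement of its kernel, and localizations are flat. -/
lemma flat_lmul'_of_isSeparable (F S : Type u) [Field F] [Field S] [Algebra F S]
    [Algebra.IsSeparable F S] : (Algebra.TensorProduct.lmul' F (S := S)).toRingHom.Flat := by
  let f := (Algebra.TensorProduct.lmul' F (S := S)).toRingHom
  let := f.toAlgebra
  let M : Submonoid (S ⊗[F] S) := (nonZeroDivisors S).comap f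
  have : IsLocalization M S := by
    refine ⟨fun y => ?_, fun z => ⟨(z ⊗ₜ[F] 1, 1), ?_⟩, fun {x y} h => ?_⟩
    · exact isUnit_iff_ne_zero.2 (nonZeroDivisors.ne_zero y.2)
    · simp [RingHom.algebraMap_toAlgebra, f]
    · obtain ⟨m, hm, h⟩ := exists_mul_eq_zero_of_lmul'_eq_zero (F := F) (S := S) (x - y) (by
        rw [map_sub, sub_eq_zero]; exact h)
      exact ⟨⟨m, mem_nonZeroDivisors_of_ne_zero hm⟩, by
        rw [← sub_eq_zero, ← mul_sub]; exact h⟩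
  exact IsLocalization.flat S M

instance weaklyEtale_of_isSeparable (F S : Type u) [Field F] [Field S] [Algebra F S]
    [Algebra.IsSeparable F S] : WeaklyEtale (Spec.map (CommRingCat.ofHom (algebraMap F S))) where
  flat := by
    rw [HasRingHomProperty.Spec_iff (P := @Flat)]
    exact RingHom.flat_algebraMap_iff.2 inferInstance
  flat_diagonal := by
    have : Flat (Spec.map (CommRingCat.ofHom (Algebra.TensorProduct.lmul' F (S := S)).toRingHom)) :=
      (HasRingHomProperty.Spec_iff (P := @Flat)).2 (flat_lmul'_of_isSeparable F S)
    rw [diagonal_SpecMap]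
    infer_instance

end WeaklyEtale

/-! ### The graphs of the Galois automorphisms cover `X ×_F S`. -/

section Graphs

variable {F S : Type u} [Field F] [Field S] [Algebra F S]

/-- `Spec` of the ring homomorphism underlying an automorphism of `S`. -/
abbrev specAut (ω : S ≃ₐ[F] S) : Spec (CommRingCat.of S) ⟶ Spec (CommRingCat.of S) :=
  Spec.map (CommRingCat.ofHom (ω : S →+* S))

/-- The projection `Spec S ⟶ Spec F`. -/
abbrev specAlg (F S : Type u) [Field F] [Field S] [Algebra F S] :
    Spec (CommRingCat.of S) ⟶ Spec (CommRingCat.of F) :=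
  Spec.map (CommRingCat.ofHom (algebraMap F S))

lemma specAut_specAlg (ω : S ≃ₐ[F] S) : specAut ω ≫ specAlg F S = specAlg F S := by
  rw [specAut, specAlg, ← Spec.map_comp, ← CommRingCat.ofHom_comp]
  congr 2
  exact RingHom.ext ω.commutes

instance : Surjective (specAlg F S) :=
  ((flat_and_surjective_SpecMap_iff _).2 (by
    rw [CommRingCat.hom_ofHom, RingHom.faithfullyFlat_algebraMap_iff]; infer_instance)).2

instance : Flat (specAlg F S) :=
  ((flat_and_surjective_SpecMap_iff _).2 (by
    rw [CommRingCat.hom_ofHom, RingHom.faithfullyFlat_algebraMap_iff]; infer_instance)).1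

variable {X T : Scheme.{u}} {str : X ⟶ Spec (CommRingCat.of S)} {t₁ : T ⟶ X}
  {t₂ : T ⟶ Spec (CommRingCat.of S)} (H : IsPullback t₁ t₂ (str ≫ specAlg F S) (specAlg F S))
  (γ : (S ≃ₐ[F] S) → (X ⟶ T)) (h₁ : ∀ ω, γ ω ≫ t₁ = 𝟙 X) (h₂ : ∀ ω, γ ω ≫ t₂ = str ≫ specAut ω)

include H h₁

/-- A section of a weakly étale morphism is weakly étale, and `t₁` is a base change of `Spec S →
Spec F`. -/
lemma weaklyEtale_of_graph [Algebra.IsSeparable F S] (ω : S ≃ₐ[F] S) : WeaklyEtale (γ ω) := by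
  have : WeaklyEtale t₁ := MorphismProperty.IsStableUnderBaseChange.of_isPullback
    (P := @WeaklyEtale) H.flip (weaklyEtale_of_isSeparable F S)
  have : WeaklyEtale (γ ω ≫ t₁) := by
    rw [h₁]
    infer_instance
  exact .of_comp (γ ω) t₁

include h₂

/-- A point `t` gives two embeddings of `S` into its residue field that agree on `F`. By normality
they differ by an automorphism `ω`, so `t` lies on the graph of `ω`. -/
lemma exists_eq_graph [Normal F S] (t : T) : ∃ (ω : S ≃ₐ[F] S) (x : X), γ ω x = t := by
  let κ := T.residueField t
  obtain ⟨i₁, hi₁⟩ := Spec.map_surjective (T.fromSpecResidueField t ≫ t₁ ≫ str)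
  obtain ⟨i₂, hi₂⟩ := Spec.map_surjective (T.fromSpecResidueField t ≫ t₂)
  have e : i₁.hom.comp (algebraMap F S) = i₂.hom.comp (algebraMap F S) := by
    have : CommRingCat.ofHom (algebraMap F S) ≫ i₁ = CommRingCat.ofHom (algebraMap F S) ≫ i₂ := by
      apply Spec.map_injective
      rw [Spec.map_comp, Spec.map_comp, hi₁, hi₂]
      simp only [Category.assoc, H.w]
    exact congrArg CommRingCat.Hom.hom this
  let := i₁.hom.toAlgebra
  let := (i₁.hom.comp (algebraMap F S)).toAlgebra
  have : IsScalarTower F S κ := .of_algebraMap_eq fun _ => rfl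
  let j : S →ₐ[F] κ := { i₂.hom with commutes' := fun x => (RingHom.congr_fun e x).symm }
  let ω : S ≃ₐ[F] S := AlgHom.restrictNormal' j S
  have hω : i₁.hom.comp (ω : S →+* S) = i₂.hom := RingHom.ext fun x =>
    AlgHom.restrictNormal_commutes j S x
  refine ⟨ω, t₁ t, ?_⟩
  have key : T.fromSpecResidueField t ≫ t₁ ≫ γ ω = T.fromSpecResidueField t := by
    apply H.hom_ext
    · simp [h₁]
    · have : CommRingCat.ofHom (ω : S →+* S) ≫ i₁ = i₂ := by ext x; exact RingHom.congr_fun hω x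
      simp only [Category.assoc, h₂]
      rw [← reassoc_of% hi₁, ← Spec.map_comp, this, hi₂]
  have hh := congrArg (fun f : Spec (T.residueField t) ⟶ T => f default) key
  simpa using hh

omit h₂ in
lemma flat_sigmaDesc_graph [Algebra.IsSeparable F S] : Flat (Sigma.desc γ) := by
  have := weaklyEtale_of_graph H γ h₁
  infer_instance

lemma surjective_sigmaDesc_graph [Normal F S] : Surjective (Sigma.desc γ) := by
  refine ⟨fun t => ?_⟩
  obtain ⟨ω, x, rfl⟩ := exists_eq_graph H γ h₁ h₂ t
  exact ⟨Sigma.ι (fun _ => X) ω x, by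
    rw [← Scheme.Hom.comp_apply, Sigma.ι_desc]⟩

end Graphs

end

/-! ### Galois descent of morphisms and of closed subschemes. -/

section

/-- A flat local homomorphism is faithfully flat, hence injective; by surjectivity every stalk of
`Y` is reached. -/
lemma app_injective_of_flat_of_surjective {X Y : Scheme.{u}} (f : X ⟶ Y) [Flat f] [Surjective f]
    (U : Y.Opens) : Function.Injective (f.app U) := by
  rw [injective_iff_map_eq_zero]
  intro s hs
  refine TopCat.Presheaf.section_ext Y.sheaf U s 0 fun y hy => ?_
  obtain ⟨x, rfl⟩ := f.surjective y
  have hinj : Function.Injective (f.stalkMap x) := by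
    algebraize [(f.stalkMap x).hom]
    have : Module.FaithfullyFlat (Y.presheaf.stalk (f x)) (X.presheaf.stalk x) :=
      @Module.FaithfullyFlat.of_flat_of_isLocalHom _ _ _ _ _ _ _
        (Flat.stalkMap f x) (f.toLRSHom.prop x)
    exact ‹RingHom.FaithfullyFlat _›.injective
  apply hinj
  have h1 := Scheme.Hom.germ_stalkMap_apply f U x hy s
  have h2 : (Y.presheaf.germ U (f x) hy) (0 : Γ(Y, U)) = 0 := map_zero _
  erw [h1, hs, h2]
  simp

/-- Functions on `Z` inject into functions on `X`, so the ideal of the closed subscheme `Y` is zero.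
-/
lemma isIso_of_isClosedImmersion_of_flat_surjective {X Y Z : Scheme.{u}} (f : X ⟶ Y) (j : Y ⟶ Z)
    [IsClosedImmersion j] [Flat (f ≫ j)] [Surjective (f ≫ j)] : IsIso j := by
  rw [IsClosedImmersion.isIso_iff_ker_eq_bot]
  ext U : 2
  rw [Scheme.Hom.ker_apply, Scheme.IdealSheafData.ideal_bot, Pi.bot_apply,
    ← RingHom.injective_iff_ker_eq_bot]
  have := app_injective_of_flat_of_surjective (f ≫ j) U
  rw [Scheme.Hom.comp_app] at this
  exact Function.Injective.of_comp (f := f.app _) this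

instance isSchemeTheoreticallyDominant_toImage {X Y : Scheme.{u}} (f : X ⟶ Y) [QuasiCompact f] :
    IsSchemeTheoreticallyDominant f.toImage := by
  rw [isSchemeTheoreticallyDominant_iff]
  refine Scheme.IdealSheafData.ext_of_iSup_eq_top
    (fun U : Y.affineOpens => ⟨f.imageι ⁻¹ᵁ U.1, U.2.preimage f.imageι⟩) ?_ fun U => ?_
  · rw [← top_le_iff]
    intro x _
    have : f.imageι x ∈ ⨆ U : Y.affineOpens, (U : Y.Opens) := by
      rw [iSup_affineOpens_eq_top]; trivial
    obtain ⟨U, hU⟩ := TopologicalSpace.Opens.mem_iSup.1 this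
    exact TopologicalSpace.Opens.mem_iSup.2 ⟨U, hU⟩
  · rw [Scheme.Hom.ker_apply, Scheme.IdealSheafData.ideal_bot, Pi.bot_apply,
      ← RingHom.injective_iff_ker_eq_bot]
    exact f.toImage_app_injective U

section Descent

variable {F S : Type u} [Field F] [Field S] [Algebra F S] [IsGalois F S]
  {X Y Z : Scheme.{u}} {str : X ⟶ Spec (CommRingCat.of S)}
  {a : (S ≃ₐ[F] S) → (X ⟶ X)}

/-- Galois descent of morphisms: a Galois-invariant morphism from the base change `X = Y_S` comes
from a morphism from `Y`. -/
theorem exists_fac_of_invariant {g : X ⟶ Y} {y : Y ⟶ Spec (CommRingCat.of F)}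
    (H : IsPullback g str y (specAlg F S)) (ha : ∀ ω, a ω ≫ str = str ≫ specAut ω)
    (hg : ∀ ω, a ω ≫ g = g) (f : X ⟶ Z) (hf : ∀ ω, a ω ≫ f = f) :
    ∃ f' : Y ⟶ Z, g ≫ f' = f := by
  have : Flat g := MorphismProperty.IsStableUnderBaseChange.of_isPullback
    (P := @Flat) H.flip inferInstance
  have : Surjective g := MorphismProperty.IsStableUnderBaseChange.of_isPullback
    (P := @Surjective) H.flip inferInstance
  have : QuasiCompact g := MorphismProperty.IsStableUnderBaseChange.of_isPullback
    (P := @QuasiCompact) H.flip inferInstance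
  have H' : IsPullback (pullback.fst g g) (pullback.snd g g ≫ str) (str ≫ specAlg F S)
      (specAlg F S) := by
    have := (IsPullback.of_hasPullback g g).paste_vert H
    rwa [H.w] at this
  let γ : (S ≃ₐ[F] S) → (X ⟶ pullback g g) := fun ω =>
    pullback.lift (𝟙 X) (a ω) (by rw [hg, Category.id_comp])
  have h₁ : ∀ ω, γ ω ≫ pullback.fst g g = 𝟙 X := fun ω => pullback.lift_fst _ _ _
  have h₂ : ∀ ω, γ ω ≫ pullback.snd g g ≫ str = str ≫ specAut ω := fun ω => by
    rw [← ha, pullback.lift_snd_assoc]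
  have := flat_sigmaDesc_graph H' γ h₁
  have := surjective_sigmaDesc_graph H' γ h₁ h₂
  -- For an infinite group the disjoint union of graphs need not be quasi-compact over the target,
  -- so fpqc descent is not applied to it; being an epimorphism suffices. The fpqc covering is `g`
  -- itself.
  have : Epi (Sigma.desc γ) := Flat.epi_of_flat_of_surjective _
  have key : pullback.fst g g ≫ f = pullback.snd g g ≫ f := by
    rw [← cancel_epi (Sigma.desc γ)]
    refine Sigma.hom_ext _ _ fun ω => ?_
    rw [Sigma.ι_desc_assoc, Sigma.ι_desc_assoc, reassoc_of% (h₁ ω), pullback.lift_snd_assoc, hf]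
  refine ⟨EffectiveEpi.desc g f fun g₁ g₂ h => ?_, EffectiveEpi.fac _ _ _⟩
  rw [← pullback.lift_fst g₁ g₂ h, Category.assoc, key, pullback.lift_snd_assoc]

/-- Galois descent of closed subschemes. -/
theorem isPullback_toImage_of_isClosedImmersion {W : Scheme.{u}} {w : W ⟶ Spec (CommRingCat.of F)}
    {g : X ⟶ W} (hgs : g ≫ w = str ≫ specAlg F S) (ha : ∀ ω, a ω ≫ str = str ≫ specAut ω)
    (hg : ∀ ω, a ω ≫ g = g) [IsClosedImmersion (pullback.lift g str hgs)] :
    IsPullback g.toImage str (g.imageι ≫ w) (specAlg F S) := by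
  let Q := pullback (g.imageι ≫ w) (specAlg F S)
  have hgs' : g.toImage ≫ g.imageι ≫ w = str ≫ specAlg F S := by
    rw [Scheme.Hom.toImage_imageι_assoc, hgs]
  let j : X ⟶ Q := pullback.lift g.toImage str hgs'
  let m : Q ⟶ pullback w (specAlg F S) := pullback.lift (pullback.fst _ _ ≫ g.imageι)
    (pullback.snd _ _) (by rw [Category.assoc, pullback.condition])
  have hjm : j ≫ m = pullback.lift g str hgs := by
    apply pullback.hom_ext <;>
      simp only [j, m, Category.assoc, pullback.lift_fst, pullback.lift_snd,
        pullback.lift_fst_assoc, Scheme.Hom.toImage_imageι]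
  have : IsSeparated (m ≫ pullback.fst w (specAlg F S)) := by
    rw [pullback.lift_fst]; infer_instance
  have : IsSeparated m := .of_comp m (pullback.fst w (specAlg F S))
  have : IsClosedImmersion (j ≫ m) := by rw [hjm]; infer_instance
  have : IsClosedImmersion j := .of_comp j m
  have : QuasiCompact g := by
    rw [← pullback.lift_fst g str hgs]; infer_instance
  let T := pullback (str ≫ specAlg F S) (specAlg F S)
  have hrw : (pullback.fst (str ≫ specAlg F S) (specAlg F S) ≫ g.toImage) ≫ g.imageι ≫ w =
      pullback.snd _ _ ≫ specAlg F S := by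
    rw [Category.assoc, hgs', pullback.condition]
  -- With `Y` the image of `g`, `Q` is `Y_S` and `T` is `X ×_F S`. Here `r` is the flat base change
  -- of `X → Y`, so it stays scheme-theoretically dominant.
  let r : T ⟶ Q := pullback.lift (pullback.fst _ _ ≫ g.toImage) (pullback.snd _ _) hrw
  have Hr : IsPullback (pullback.fst _ _) r g.toImage (pullback.fst (g.imageι ≫ w) _) := by
    have h : IsPullback (r ≫ pullback.snd _ _) (pullback.fst _ _) (specAlg F S)
        (g.toImage ≫ g.imageι ≫ w) := by
      rw [hgs', pullback.lift_snd]
      exact (IsPullback.of_hasPullback _ _).flip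
    exact (h.of_right (pullback.lift_fst _ _ _) (IsPullback.of_hasPullback _ _).flip).flip
  have : IsSchemeTheoreticallyDominant r := .of_isPullback Hr
  let γ : (S ≃ₐ[F] S) → (X ⟶ T) := fun ω =>
    pullback.lift (𝟙 X) (str ≫ specAut ω) (by
      rw [Category.id_comp, Category.assoc, specAut_specAlg])
  have h₁ : ∀ ω, γ ω ≫ pullback.fst _ _ = 𝟙 X := fun ω => pullback.lift_fst _ _ _
  have h₂ : ∀ ω, γ ω ≫ pullback.snd _ _ = str ≫ specAut ω := fun ω => pullback.lift_snd _ _ _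
  have hat : ∀ ω, a ω ≫ g.toImage = g.toImage := fun ω => by
    rw [← cancel_mono g.imageι, Category.assoc, Scheme.Hom.toImage_imageι, hg]
  have hγ : ∀ ω, γ ω ≫ r = a ω ≫ j := fun ω => by
    apply pullback.hom_ext
    · simp only [Category.assoc, r, j, pullback.lift_fst, reassoc_of% (h₁ ω), hat]
    · simp only [Category.assoc, r, j, pullback.lift_snd, h₂ ω, ha]
  have := flat_sigmaDesc_graph (IsPullback.of_hasPullback _ _) γ h₁
  have := surjective_sigmaDesc_graph (IsPullback.of_hasPullback _ _) γ h₁ h₂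
  let γ' : (S ≃ₐ[F] S) → (X ⟶ pullback r j) := fun ω => pullback.lift (γ ω) (a ω) (hγ ω)
  have e : Sigma.desc γ' ≫ pullback.fst r j = Sigma.desc γ := by
    refine Sigma.hom_ext _ _ fun ω => ?_
    rw [Sigma.ι_desc_assoc, Sigma.ι_desc, pullback.lift_fst]
  -- On the graph of `ω` the map `r` equals `a ω ≫ j`, so every graph factors through the closed
  -- subscheme `r⁻¹(X)` of `T`. As the graphs cover `T` flatly, that subscheme is all of `T`: `r`
  -- factors through `j`, and dominance of `r` forces `j` to be an isomorphism.
  have : IsIso (pullback.fst r j) := by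
    have : Flat (Sigma.desc γ' ≫ pullback.fst r j) := by rwa [e]
    have : Surjective (Sigma.desc γ' ≫ pullback.fst r j) := by rwa [e]
    exact isIso_of_isClosedImmersion_of_flat_surjective (Sigma.desc γ') _
  have hr : r = (inv (pullback.fst r j) ≫ pullback.snd r j) ≫ j := by
    rw [Category.assoc, ← pullback.condition, IsIso.inv_hom_id_assoc]
  have : IsIso j := by
    rw [IsClosedImmersion.isIso_iff_ker_eq_bot, ← le_bot_iff, ← r.ker_eq_bot]
    conv_rhs => rw [hr]
    exact Scheme.Hom.le_ker_comp _ _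
  exact .of_iso_pullback ⟨hgs'⟩ (asIso j) (pullback.lift_fst _ _ _) (pullback.lift_snd _ _ _)

end Descent

end

/-! ### Galois descent of locally closed subschemes. -/

section

section Descent

variable {F S : Type u} [Field F] [Field S] [Algebra F S] [IsGalois F S]
  {X Y Z : Scheme.{u}} {str : X ⟶ Spec (CommRingCat.of S)}
  {a : (S ≃ₐ[F] S) → (X ⟶ X)}

omit [IsGalois F S] in
-- `X ×_Y X = X ×_F S`; this lets graphs in the kernel pair be treated as graphs over `S`.
lemma isPullback_kernelPair {g : X ⟶ Y} {y : Y ⟶ Spec (CommRingCat.of F)}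
    (H : IsPullback g str y (specAlg F S)) :
    IsPullback (pullback.fst g g) (pullback.snd g g ≫ str) (str ≫ specAlg F S)
      (specAlg F S) := by
  have := (IsPullback.of_hasPullback g g).paste_vert H
  rwa [H.w] at this

/-- The Galois group acts transitively on the fibres of `Y_S ⟶ Y`. -/
lemma exists_apply_eq_of_apply_eq {g : X ⟶ Y} {y : Y ⟶ Spec (CommRingCat.of F)}
    (H : IsPullback g str y (specAlg F S)) (ha : ∀ ω, a ω ≫ str = str ≫ specAut ω)
    (hg : ∀ ω, a ω ≫ g = g) {x x' : X} (h : g x = g x') : ∃ ω, a ω x = x' := by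
  obtain ⟨t, ht, ht'⟩ := Scheme.Pullback.exists_preimage_pullback x x' h
  obtain ⟨ω, z, rfl⟩ := exists_eq_graph (isPullback_kernelPair H)
    (fun ω => pullback.lift (𝟙 X) (a ω) (by rw [hg, Category.id_comp]))
    (fun ω => pullback.lift_fst _ _ _)
    (fun ω => by rw [← ha, pullback.lift_snd_assoc]) t
  rw [← Scheme.Hom.comp_apply, pullback.lift_fst] at ht
  replace ht : z = x := ht
  rw [← Scheme.Hom.comp_apply, pullback.lift_snd] at ht'
  exact ⟨ω, ht ▸ ht'⟩

instance [Algebra.IsAlgebraic F S] : IsIntegralHom (specAlg F S) :=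
  IsIntegralHom.SpecMap_iff.2 (algebraMap_isIntegral_iff.2 inferInstance)

/-- Galois descent of locally closed subschemes. -/
theorem exists_isPullback_of_isImmersion {P : Scheme.{u}} {s : P ⟶ Spec (CommRingCat.of F)}
    {g : X ⟶ P} (hgs : g ≫ s = str ≫ specAlg F S) (ha : ∀ ω, a ω ≫ str = str ≫ specAut ω)
    (hg : ∀ ω, a ω ≫ g = g) (hs : ∀ ω, Surjective (a ω)) [IsImmersion (pullback.lift g str hgs)] :
    ∃ (Y : Scheme.{u}) (t : X ⟶ Y) (e : Y ⟶ P), t ≫ e = g ∧ IsImmersion e ∧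
      IsPullback t str (e ≫ s) (specAlg F S) := by
  let i := pullback.lift g str hgs
  have hi₁ : i ≫ pullback.fst _ _ = g := pullback.lift_fst _ _ _
  let π := pullback.fst s (specAlg F S)
  let b : (S ≃ₐ[F] S) → (pullback s (specAlg F S) ⟶ pullback s (specAlg F S)) := fun ω =>
    pullback.lift π (pullback.snd _ _ ≫ specAut ω) (by
      rw [Category.assoc, specAut_specAlg, pullback.condition])
  have hbπ : ∀ ω, b ω ≫ π = π := fun ω => pullback.lift_fst _ _ _
  have hbs : ∀ ω, b ω ≫ pullback.snd _ _ = pullback.snd _ _ ≫ specAut ω :=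
    fun ω => pullback.lift_snd _ _ _
  have hib : ∀ ω, i ≫ b ω = a ω ≫ i := fun ω => by
    apply pullback.hom_ext
    · simp only [i, b, π, Category.assoc, pullback.lift_fst, hg]
    · simp only [i, b, π, Category.assoc, pullback.lift_snd, pullback.lift_snd_assoc, ha]
  have hbb : ∀ ω, b ω ≫ b ω⁻¹ = 𝟙 _ := fun ω => by
    apply pullback.hom_ext
    · rw [Category.assoc, Category.id_comp, hbπ, hbπ]
    · rw [Category.assoc, Category.id_comp, hbs, reassoc_of% (hbs ω), ← Spec.map_comp,
        ← CommRingCat.ofHom_comp]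
      have : ((ω : S →+* S).comp ((ω⁻¹ : S ≃ₐ[F] S) : S →+* S)) = RingHom.id S :=
        RingHom.ext fun x => ω.apply_symm_apply x
      rw [this]
      simp
  have hbinj : ∀ ω, Function.Injective (b ω) := fun ω x x' h => by
    have h' := congrArg (b ω⁻¹) h
    simp only [← Scheme.Hom.comp_apply, hbb] at h'
    exact h'
  -- The boundary `B` is closed because the range is locally closed, and it is Galois-stable.
  let B : Set ↥(pullback s (specAlg F S)) := closure (Set.range i) \ Set.range i
  have hBc : IsClosed B := by
    have := i.isLocallyClosed_range.isOpen_coborder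
    rw [← isOpen_compl_iff]
    exact this
  have hB : ∀ ω x, x ∈ B → b ω x ∈ B := fun ω x hx => by
    have himg : b ω '' Set.range i = Set.range i := by
      rw [← Set.range_comp, ← TopCat.coe_comp, ← Scheme.Hom.comp_base, hib, Scheme.Hom.comp_base,
        TopCat.coe_comp, Set.range_comp, (hs ω).surj.range_eq, Set.image_univ]
    refine ⟨?_, fun h => hx.2 ?_⟩
    · rw [← himg]
      exact image_closure_subset_closure_image (b ω).continuous ⟨x, hx.1, rfl⟩
    · rw [← himg] at h
      exact (hbinj ω).mem_set_image.1 h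
  have hπ : IsClosedMap π := π.isClosedMap
  -- The image of `B` under the integral map `π` is closed. Since the Galois group is transitive on
  -- the fibres of `π` and preserves `B`, the preimage of `O` is exactly the complement of `B`,
  -- where `X` is closed. The closed case then applies over `O`.
  let O : P.Opens := ⟨(π '' B)ᶜ, (hπ B hBc).isOpen_compl⟩
  have hO : ∀ x, π x ∈ O → x ∉ B := fun x hx hxB => hx ⟨x, hxB, rfl⟩
  have hO' : ∀ x, x ∉ B → π x ∈ O := by
    rintro x hxB ⟨x', hx', h⟩
    obtain ⟨ω, rfl⟩ := exists_apply_eq_of_apply_eq (IsPullback.of_hasPullback s (specAlg F S))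
      hbs hbπ h
    exact hxB (hB ω x' hx')
  let gO : X ⟶ O := IsOpenImmersion.lift O.ι g (by
    rintro _ ⟨x, rfl⟩
    rw [Scheme.Opens.range_ι, ← hi₁, Scheme.Hom.comp_apply]
    exact hO' _ fun h => h.2 ⟨x, rfl⟩)
  have hgO : gO ≫ O.ι = g := IsOpenImmersion.lift_fac _ _ _
  have hgOs : gO ≫ O.ι ≫ s = str ≫ specAlg F S := by rw [reassoc_of% hgO, hgs]
  have hagO : ∀ ω, a ω ≫ gO = gO := fun ω => by
    rw [← cancel_mono O.ι, Category.assoc, hgO, hg]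
  let n : pullback (O.ι ≫ s) (specAlg F S) ⟶ pullback s (specAlg F S) :=
    pullback.lift (pullback.fst _ _ ≫ O.ι) (pullback.snd _ _) (by
      rw [Category.assoc, pullback.condition])
  have hn₁ : n ≫ π = pullback.fst _ _ ≫ O.ι := pullback.lift_fst _ _ _
  have Hn : IsPullback (pullback.fst _ _) n O.ι π := by
    have h : IsPullback (n ≫ pullback.snd _ _) (pullback.fst _ _) (specAlg F S) (O.ι ≫ s) := by
      rw [pullback.lift_snd]
      exact (IsPullback.of_hasPullback _ _).flip
    exact (h.of_right hn₁ (IsPullback.of_hasPullback _ _).flip).flip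
  have : IsOpenImmersion n := MorphismProperty.IsStableUnderBaseChange.of_isPullback
    (P := @IsOpenImmersion) Hn inferInstance
  let j := pullback.lift gO str hgOs
  have hjn : j ≫ n = i := by
    apply pullback.hom_ext
    · simp only [i, j, n, Category.assoc, pullback.lift_fst, pullback.lift_fst_assoc, hgO]
    · simp only [i, j, n, Category.assoc, pullback.lift_snd]
  have : IsImmersion (j ≫ n) := by rw [hjn]; infer_instance
  have : IsImmersion j := .of_comp j n
  have : IsClosedImmersion j := by
    refine .of_isPreimmersion j ?_
    have : Set.range j = n ⁻¹' closure (Set.range i) := by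
      ext w
      have hw : n w ∉ B := hO _ (by
        rw [← Scheme.Hom.comp_apply, hn₁, Scheme.Hom.comp_apply]
        exact (pullback.fst (O.ι ≫ s) (specAlg F S) w).2)
      constructor
      · rintro ⟨x, rfl⟩
        rw [Set.mem_preimage, ← Scheme.Hom.comp_apply, hjn]
        exact subset_closure ⟨x, rfl⟩
      · intro h
        obtain ⟨x, hx⟩ : n w ∈ Set.range i := by
          by_contra h'
          exact hw ⟨h, h'⟩
        refine ⟨x, n.isOpenEmbedding.injective ?_⟩
        rw [← Scheme.Hom.comp_apply, hjn, hx]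
    rw [this]
    exact isClosed_closure.preimage n.continuous
  refine ⟨gO.image, gO.toImage, gO.imageι ≫ O.ι, ?_, inferInstance, ?_⟩
  · rw [Scheme.Hom.toImage_imageι_assoc, hgO]
  · have := isPullback_toImage_of_isClosedImmersion hgOs ha hagO
    rwa [Category.assoc]

end Descent

end

/-! ### Morphisms to `Proj` from homomorphisms to global sections. -/

section

lemma isUnit_of_forall_mem_basicOpen {T : Scheme.{u}} {s : Γ(T, ⊤)} (h : ∀ x, x ∈ T.basicOpen s) :
    IsUnit s :=
  RingedSpace.isUnit_of_isUnit_germ T.toSheafedSpace ⊤ s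
    fun x hx => (T.mem_basicOpen s x hx).1 (h x)

lemma isUnit_appTop_iff {T T' : Scheme.{u}} (h : T' ⟶ T) (s : Γ(T, ⊤)) :
    IsUnit (h.appTop s) ↔ ∀ x, h x ∈ T.basicOpen s := by
  have e := Scheme.preimage_basicOpen_top h s
  refine ⟨fun hu x => ?_, fun H => isUnit_of_forall_mem_basicOpen fun x => ?_⟩
  · have hx : x ∈ T'.basicOpen (h.appTop s) := by
      rw [T'.basicOpen_of_isUnit hu]; trivial
    rw [← e] at hx
    exact hx
  · rw [← e]
    exact H x

lemma isUnit_ι_appTop {T : Scheme.{u}} (s : Γ(T, ⊤)) {U : T.Opens} (hU : U ≤ T.basicOpen s) :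
    IsUnit (U.ι.appTop s) :=
  (isUnit_appTop_iff _ _).2 fun x => hU x.2

lemma toSpecΓ_SpecMap_injective {T : Scheme.{u}} {R : Type u} [CommRing R]
    {φ ψ : R →+* Γ(T, ⊤)} (h : T.toSpecΓ ≫ Spec.map (CommRingCat.ofHom φ) =
      T.toSpecΓ ≫ Spec.map (CommRingCat.ofHom ψ)) : φ = ψ := by
  have h2 := congrArg Scheme.Hom.appTop h
  simp only [Scheme.Hom.comp_appTop, Scheme.toSpecΓ_appTop, Scheme.ΓSpecIso_naturality] at h2
  exact congrArg CommRingCat.Hom.hom ((cancel_epi _).1 h2)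

open HomogeneousLocalization

section Represents

variable {A : Type u} {σ : Type*} [CommRing A] [SetLike σ A] [AddSubgroupClass σ A] (𝒜 : ℕ → σ)
  [GradedRing 𝒜]

/-- The homomorphism `𝒜_(f) → B` induced by a homomorphism `A → B` mapping `f` to a unit. -/
def awayLift {B : Type*} [CommRing B] (φ : A →+* B) {f : A} (hf : IsUnit (φ f)) : Away 𝒜 f →+* B :=
  (IsLocalization.Away.lift (S := Localization.Away f) f hf).comp
    (algebraMap (Away 𝒜 f) (Localization.Away f))

lemma awayLift_mk {B : Type*} [CommRing B] (φ : A →+* B) {f : A} (hf : IsUnit (φ f)) {d n : ℕ}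
    (hd : f ∈ 𝒜 d) {x : A} (hx : x ∈ 𝒜 (n • d)) :
    awayLift 𝒜 φ hf (Away.mk 𝒜 hd n x hx) * φ f ^ n = φ x := by
  have h1 : (algebraMap (Away 𝒜 f) (Localization.Away f)) (Away.mk 𝒜 hd n x hx) *
      algebraMap A (Localization.Away f) (f ^ n) = algebraMap A (Localization.Away f) x := by
    rw [HomogeneousLocalization.algebraMap_apply, Away.val_mk, Localization.mk_eq_mk']
    exact IsLocalization.mk'_spec _ x (⟨f ^ n, ⟨n, rfl⟩⟩ : Submonoid.powers f)
  have h2 := congrArg (IsLocalization.Away.lift (S := Localization.Away f) f hf) h1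
  rw [map_mul, IsLocalization.Away.lift_eq, IsLocalization.Away.lift_eq, map_pow] at h2
  exact h2

/-- Every element of `𝒜_(f)` is some `x / fⁿ`, and `φ f` is a unit, so these equations determine
`ψ`. -/
lemma eq_awayLift {B : Type*} [CommRing B] (φ : A →+* B) {f : A} (hf : IsUnit (φ f)) {d : ℕ}
    (hd : f ∈ 𝒜 d) (ψ : Away 𝒜 f →+* B)
    (h : ∀ n x (hx : x ∈ 𝒜 (n • d)), ψ (Away.mk 𝒜 hd n x hx) * φ f ^ n = φ x) :
    ψ = awayLift 𝒜 φ hf := by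
  ext y
  obtain ⟨n, x, hx, rfl⟩ := Away.mk_surjective 𝒜 hd y
  exact (hf.pow n).mul_left_injective ((h n x hx).trans (awayLift_mk 𝒜 φ hf hd hx).symm)

variable {T T' : Scheme.{u}}

/-- The morphism `T ⟶ D₊(f) ⊆ Proj 𝒜` given by a homomorphism `φ : A → Γ(T)` for which `φ f` is
a unit. -/
def toProj (φ : A →+* Γ(T, ⊤)) {f : A} {d : ℕ} (hd : f ∈ 𝒜 d) (h0 : 0 < d) (hu : IsUnit (φ f)) :
    T ⟶ Proj 𝒜 :=
  T.toSpecΓ ≫ Spec.map (CommRingCat.ofHom (awayLift 𝒜 φ hu)) ≫ Proj.awayι 𝒜 f hd h0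

lemma comp_toProj (h : T' ⟶ T) (φ : A →+* Γ(T, ⊤)) {f : A} {d : ℕ} (hd : f ∈ 𝒜 d) (h0 : 0 < d)
    (hu : IsUnit (φ f)) (hu' : IsUnit (h.appTop.hom.comp φ f)) :
    h ≫ toProj 𝒜 φ hd h0 hu = toProj 𝒜 (h.appTop.hom.comp φ) hd h0 hu' := by
  rw [toProj, toProj, Scheme.toSpecΓ_naturality_assoc, ← Spec.map_comp_assoc]
  congr 3
  ext1
  refine eq_awayLift 𝒜 (h.appTop.hom.comp φ) hu' hd _ fun n x hx => ?_
  simp only [CommRingCat.hom_comp, CommRingCat.hom_ofHom, RingHom.comp_apply]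
  rw [← map_pow, ← map_mul, awayLift_mk]

lemma toProj_mul (φ : A →+* Γ(T, ⊤)) {f g : A} {d e : ℕ} (hd : f ∈ 𝒜 d) (h0 : 0 < d)
    (he : g ∈ 𝒜 e) (hf : IsUnit (φ f)) (hg : IsUnit (φ g)) :
    toProj 𝒜 φ hd h0 hf = toProj 𝒜 φ (SetLike.mul_mem_graded hd he)
      (h0.trans_le (d.le_add_right e)) (by rw [map_mul]; exact hf.mul hg) := by
  rw [toProj, toProj, ← Proj.SpecMap_awayMap_awayι 𝒜 hd h0 he rfl, ← Spec.map_comp_assoc]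
  congr 3
  ext1
  refine (eq_awayLift 𝒜 φ hf hd _ fun n x hx => ?_).symm
  simp only [CommRingCat.hom_comp, CommRingCat.hom_ofHom, RingHom.comp_apply, awayMap_mk]
  refine (hg.pow n).mul_left_injective ?_
  simp only
  rw [mul_assoc, ← mul_pow]
  have := awayLift_mk 𝒜 φ (f := f * g) (by rw [map_mul]; exact hf.mul hg)
    (SetLike.mul_mem_graded hd he) (n := n) (x := x * g ^ n)
    (by rw [smul_add]; exact SetLike.mul_mem_graded hx (SetLike.pow_mem_graded n he))
  have e1 : (φ f * φ g) ^ n = φ (f * g) ^ n := by rw [map_mul]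
  rw [e1]
  exact this.trans (by rw [map_mul, map_pow])

/-- Both sides factor through `D₊(f * g)`, so the morphism does not depend on the chart. -/
lemma toProj_eq (φ : A →+* Γ(T, ⊤)) {f g : A} {d e : ℕ} (hd : f ∈ 𝒜 d) (h0 : 0 < d)
    (he : g ∈ 𝒜 e) (h0' : 0 < e) (hf : IsUnit (φ f)) (hg : IsUnit (φ g)) :
    toProj 𝒜 φ hd h0 hf = toProj 𝒜 φ he h0' hg := by
  rw [toProj_mul 𝒜 φ hd h0 he hf hg, toProj_mul 𝒜 φ he h0' hd hg hf]
  simp only [mul_comm g f, add_comm e d]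

lemma appTop_comp_appTop_comp {T'' : Scheme.{u}} (h' : T'' ⟶ T') (h : T' ⟶ T)
    {B : Type*} [CommRing B] (φ : B →+* Γ(T, ⊤)) :
    h'.appTop.hom.comp (h.appTop.hom.comp φ) = (h' ≫ h).appTop.hom.comp φ := by
  rw [Scheme.Hom.comp_appTop, CommRingCat.hom_comp, RingHom.comp_assoc]

/-- The morphism `e : T ⟶ Proj 𝒜` is given, in homogeneous coordinates, by the homomorphism
`φ : A → Γ(T)`. -/
structure Represents (e : T ⟶ Proj 𝒜) (φ : A →+* Γ(T, ⊤)) : Prop where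
  exists_mem : ∀ x : T, ∃ (d : ℕ) (f : A), 0 < d ∧ f ∈ 𝒜 d ∧ x ∈ T.basicOpen (φ f)
  comp_eq : ∀ {T' : Scheme.{u}} (h : T' ⟶ T) {d : ℕ} {f : A} (hd : f ∈ 𝒜 d) (h0 : 0 < d)
    (hu : IsUnit (h.appTop.hom.comp φ f)), h ≫ e = toProj 𝒜 (h.appTop.hom.comp φ) hd h0 hu

variable {𝒜}

lemma Represents.comp {e : T ⟶ Proj 𝒜} {φ : A →+* Γ(T, ⊤)} (H : Represents 𝒜 e φ) (h : T' ⟶ T) :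
    Represents 𝒜 (h ≫ e) (h.appTop.hom.comp φ) where
  exists_mem x := by
    obtain ⟨d, f, hd, hf, hx⟩ := H.exists_mem (h x)
    exact ⟨d, f, hd, hf, by
      rw [RingHom.comp_apply, ← Scheme.preimage_basicOpen_top]
      exact hx⟩
  comp_eq h' d f hd h0 hu := by
    have e1 := appTop_comp_appTop_comp h' h φ
    have := H.comp_eq (h' ≫ h) hd h0 (by rwa [← e1])
    rw [← Category.assoc, this]
    simp only [e1]

/-- Near each point some form of positive degree becomes a unit, and there both morphisms are the
one given by the chart of that form. -/
lemma Represents.ext {e e' : T ⟶ Proj 𝒜} {φ : A →+* Γ(T, ⊤)} (H : Represents 𝒜 e φ)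
    (H' : Represents 𝒜 e' φ) : e = e' := by
  refine Scheme.hom_ext_of_forall _ _ fun x => ?_
  obtain ⟨d, f, h0, hf, hx⟩ := H.exists_mem x
  refine ⟨T.basicOpen (φ f), hx, ?_⟩
  rw [H.comp_eq _ hf h0 (isUnit_ι_appTop _ le_rfl), H'.comp_eq _ hf h0 (isUnit_ι_appTop _ le_rfl)]

lemma Represents.comp_eq_comp {T₁ T₂ W : Scheme.{u}} {h₁ : T₁ ⟶ T} {h₂ : T₂ ⟶ T}
    {e₁ : T₁ ⟶ Proj 𝒜} {e₂ : T₂ ⟶ Proj 𝒜} {φ : A →+* Γ(T, ⊤)}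
    (H₁ : Represents 𝒜 e₁ (h₁.appTop.hom.comp φ)) (H₂ : Represents 𝒜 e₂ (h₂.appTop.hom.comp φ))
    (p₁ : W ⟶ T₁) (p₂ : W ⟶ T₂) (hp : p₁ ≫ h₁ = p₂ ≫ h₂) : p₁ ≫ e₁ = p₂ ≫ e₂ := by
  have h := H₂.comp p₂
  rw [appTop_comp_appTop_comp, ← hp, ← appTop_comp_appTop_comp] at h
  exact (H₁.comp p₁).ext h

lemma represents_toProj (φ : A →+* Γ(T, ⊤)) {f : A} {d : ℕ} (hd : f ∈ 𝒜 d) (h0 : 0 < d)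
    (hu : IsUnit (φ f)) : Represents 𝒜 (toProj 𝒜 φ hd h0 hu) φ where
  exists_mem x := ⟨d, f, h0, hd, by rw [T.basicOpen_of_isUnit hu]; trivial⟩
  comp_eq h d' f' hd' h0' hu' := by
    rw [comp_toProj 𝒜 h φ hd h0 hu (by rw [RingHom.comp_apply]; exact hu.map _)]
    exact toProj_eq _ _ _ _ _ _ _ _

lemma Represents.of_forall_exists {e : T ⟶ Proj 𝒜} {φ : A →+* Γ(T, ⊤)}
    (H : ∀ x : T, ∃ U : T.Opens, x ∈ U ∧ Represents 𝒜 (U.ι ≫ e) (U.ι.appTop.hom.comp φ)) :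
    Represents 𝒜 e φ where
  exists_mem x := by
    obtain ⟨U, hx, hU⟩ := H x
    obtain ⟨d, f, h0, hf, h⟩ := hU.exists_mem ⟨x, hx⟩
    refine ⟨d, f, h0, hf, ?_⟩
    rw [RingHom.comp_apply, ← Scheme.preimage_basicOpen_top] at h
    exact h
  comp_eq {T'} h d f hd h0 hu := by
    refine Scheme.hom_ext_of_forall _ _ fun x => ?_
    obtain ⟨U, hx, hU⟩ := H (h x)
    refine ⟨h ⁻¹ᵁ U, hx, ?_⟩
    let hU' : (h ⁻¹ᵁ U).toScheme ⟶ U := h ∣_ U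
    have e1 : hU' ≫ U.ι = (h ⁻¹ᵁ U).ι ≫ h := morphismRestrict_ι h U
    have e2 : hU'.appTop.hom.comp (U.ι.appTop.hom.comp φ) =
        (h ⁻¹ᵁ U).ι.appTop.hom.comp (h.appTop.hom.comp φ) := by
      rw [← RingHom.comp_assoc, ← CommRingCat.hom_comp, ← Scheme.Hom.comp_appTop, e1,
        Scheme.Hom.comp_appTop, CommRingCat.hom_comp, RingHom.comp_assoc]
    have hu' : IsUnit ((h ⁻¹ᵁ U).ι.appTop.hom.comp (h.appTop.hom.comp φ) f) := by
      rw [RingHom.comp_apply]; exact hu.map _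
    have := hU.comp_eq hU' hd h0 (by rwa [e2])
    rw [comp_toProj 𝒜 _ _ _ _ _ hu', ← Category.assoc, ← e1, Category.assoc, this]
    simp only [e2]

lemma exists_represents (φ : A →+* Γ(T, ⊤))
    (H : ∀ x : T, ∃ (d : ℕ) (f : A), 0 < d ∧ f ∈ 𝒜 d ∧ x ∈ T.basicOpen (φ f)) :
    ∃ e : T ⟶ Proj 𝒜, Represents 𝒜 e φ := by
  choose d f h0 hf hx using H
  let U : T → T.Opens := fun x => T.basicOpen (φ (f x))
  have hU : TopologicalSpace.IsOpenCover U := by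
    rw [TopologicalSpace.IsOpenCover, ← top_le_iff]
    exact fun x _ => TopologicalSpace.Opens.mem_iSup.2 ⟨x, hx x⟩
  let 𝒰 : T.OpenCover := T.openCoverOfIsOpenCover U hU
  have hu : ∀ x, IsUnit ((U x).ι.appTop.hom.comp φ (f x)) := fun x => isUnit_ι_appTop _ le_rfl
  have hR := fun x => represents_toProj (𝒜 := 𝒜) _ (hf x) (h0 x) (hu x)
  let e := 𝒰.glueMorphisms (fun x => toProj 𝒜 _ (hf x) (h0 x) (hu x)) (fun x y => by
    exact (hR x).comp_eq_comp (hR y) _ _ pullback.condition)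
  refine ⟨e, .of_forall_exists fun x => ⟨U x, hx x, ?_⟩⟩
  have : (U x).ι ≫ e = toProj 𝒜 _ (hf x) (h0 x) (hu x) := 𝒰.ι_glueMorphisms _ _ x
  rw [this]
  exact hR x

end Represents

end

/-! ### Scaling, comparison and structure morphisms of representing homomorphisms. -/

section

open HomogeneousLocalization

/-- The ring homomorphism on global sections corresponding to a morphism to a spectrum. -/
def sectionsHom {T : Scheme.{u}} {R : Type u} [CommRing R] (f : T ⟶ Spec (CommRingCat.of R)) :
    R →+* Γ(T, ⊤) :=
  ((Scheme.ΓSpecIso (CommRingCat.of R)).inv ≫ f.appTop).hom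

lemma toSpecΓ_SpecMap_sectionsHom {T : Scheme.{u}} {R : Type u} [CommRing R]
    (f : T ⟶ Spec (CommRingCat.of R)) :
    T.toSpecΓ ≫ Spec.map (CommRingCat.ofHom (sectionsHom f)) = f := by
  rw [sectionsHom, CommRingCat.ofHom_hom, Spec.map_comp, ← Scheme.toSpecΓ_naturality_assoc,
    toSpecΓ_SpecMap_ΓSpecIso_inv, Category.comp_id]

lemma sectionsHom_comp {T T' : Scheme.{u}} {R : Type u} [CommRing R] (h : T' ⟶ T)
    (f : T ⟶ Spec (CommRingCat.of R)) : sectionsHom (h ≫ f) = h.appTop.hom.comp (sectionsHom f) := by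
  rw [sectionsHom, Scheme.Hom.comp_appTop, ← Category.assoc, CommRingCat.hom_comp]
  rfl

lemma sectionsHom_comp_SpecMap {T : Scheme.{u}} {R R' : Type u} [CommRing R] [CommRing R']
    (f : T ⟶ Spec (CommRingCat.of R)) (r : R' →+* R) :
    sectionsHom (f ≫ Spec.map (CommRingCat.ofHom r)) = (sectionsHom f).comp r := by
  apply toSpecΓ_SpecMap_injective
  rw [toSpecΓ_SpecMap_sectionsHom, CommRingCat.ofHom_comp, Spec.map_comp, ← Category.assoc,
    toSpecΓ_SpecMap_sectionsHom]

section Represents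

variable {A : Type u} {σ : Type*} [CommRing A] [SetLike σ A] [AddSubgroupClass σ A] {𝒜 : ℕ → σ}
  [GradedRing 𝒜] {T : Scheme.{u}}

/-- In a ratio `x / fᵐ` of total degree zero, the powers of `c` cancel. -/
lemma Represents.of_scale {e : T ⟶ Proj 𝒜} {φ φ' : A →+* Γ(T, ⊤)} (H : Represents 𝒜 e φ)
    {c : Γ(T, ⊤)} (hc : IsUnit c) (h : ∀ n, ∀ f ∈ 𝒜 n, φ' f = c ^ n * φ f) :
    Represents 𝒜 e φ' where
  exists_mem x := by
    obtain ⟨d, f, h0, hf, hx⟩ := H.exists_mem x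
    refine ⟨d, f, h0, hf, ?_⟩
    rw [h d f hf, Scheme.basicOpen_mul, Scheme.basicOpen_of_isUnit _ (hc.pow d)]
    exact ⟨trivial, hx⟩
  comp_eq {T'} g d f hd h0 hu := by
    have hc' : IsUnit (g.appTop.hom c) := hc.map _
    have h' : ∀ n, ∀ f ∈ 𝒜 n, g.appTop.hom.comp φ' f = g.appTop.hom c ^ n * g.appTop.hom.comp φ f :=
      fun n f hf => by rw [RingHom.comp_apply, h n f hf, map_mul, map_pow]; rfl
    have hu' : IsUnit (g.appTop.hom.comp φ f) := by
      rw [h' d f hd] at hu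
      exact isUnit_of_mul_isUnit_right hu
    rw [H.comp_eq g hd h0 hu', toProj, toProj]
    congr 4
    refine eq_awayLift 𝒜 _ hu hd _ fun n x hx => ?_
    rw [h' d f hd, h' _ x hx, ← awayLift_mk 𝒜 _ hu' hd hx, mul_pow, ← pow_mul, smul_eq_mul,
      mul_comm d n]
    ring

lemma Represents.preimage_basicOpen_of_isUnit {e : T ⟶ Proj 𝒜} {φ : A →+* Γ(T, ⊤)}
    (H : Represents 𝒜 e φ) {d : ℕ} {f : A} (hf : f ∈ 𝒜 d) (h0 : 0 < d) {d' : ℕ} {g : A}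
    (hg : g ∈ 𝒜 d') (h0' : 0 < d') (hu : IsUnit (φ f)) :
    e ⁻¹ᵁ Proj.basicOpen 𝒜 g = T.basicOpen (φ g) := by
  have h1 : e = toProj 𝒜 φ hf h0 hu := by
    have := H.ext (represents_toProj (𝒜 := 𝒜) φ hf h0 hu)
    exact this
  have h2 : awayLift 𝒜 φ hu (Away.isLocalizationElem hf hg) * φ f ^ d' = φ g ^ d := by
    rw [Away.isLocalizationElem, awayLift_mk, map_pow]
  rw [h1, toProj, Scheme.Hom.comp_preimage, Scheme.Hom.comp_preimage,
    Proj.awayι_preimage_basicOpen 𝒜 hf h0 hg h0']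
  trans T.basicOpen (awayLift 𝒜 φ hu (Away.isLocalizationElem hf hg))
  · exact Scheme.toSpecΓ_preimage_basicOpen T
      (awayLift 𝒜 φ hu (Away.isLocalizationElem hf hg))
  · rw [← T.basicOpen_pow (φ g) h0, ← h2, Scheme.basicOpen_mul,
      Scheme.basicOpen_of_isUnit _ (hu.pow d'), inf_top_eq]

lemma Represents.mem_basicOpen_iff {e : T ⟶ Proj 𝒜} {φ : A →+* Γ(T, ⊤)} (H : Represents 𝒜 e φ)
    {d : ℕ} {f : A} (hf : f ∈ 𝒜 d) (h0 : 0 < d) (x : T) :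
    x ∈ T.basicOpen (φ f) ↔ e x ∈ Proj.basicOpen 𝒜 f := by
  obtain ⟨d', g, h0', hg, hx⟩ := H.exists_mem x
  have h := (H.comp (T.basicOpen (φ g)).ι).preimage_basicOpen_of_isUnit hg h0' hf h0
    (isUnit_ι_appTop _ le_rfl)
  rw [RingHom.comp_apply, ← Scheme.preimage_basicOpen_top] at h
  have h' := SetLike.ext_iff.1 h ⟨x, hx⟩
  exact h'.symm

/-- The ratio `x / f` is a function pulled back along `e`, so it has the same value for both
representing homomorphisms. -/
lemma Represents.mul_eq_mul {e : T ⟶ Proj 𝒜} {φ φ' : A →+* Γ(T, ⊤)} (H : Represents 𝒜 e φ)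
    (H' : Represents 𝒜 e φ') {d : ℕ} {f : A} (hf : f ∈ 𝒜 d) (h0 : 0 < d) (hu : IsUnit (φ f))
    (hu' : IsUnit (φ' f)) {x : A} (hx : x ∈ 𝒜 d) : φ x * φ' f = φ' x * φ f := by
  have h1 := H.ext (represents_toProj (𝒜 := 𝒜) φ hf h0 hu)
  have h2 := H'.ext (represents_toProj (𝒜 := 𝒜) φ' hf h0 hu')
  rw [h1, toProj, toProj, ← Category.assoc, ← Category.assoc, cancel_mono] at h2
  have h3 := toSpecΓ_SpecMap_injective h2
  have hx' : x ∈ 𝒜 (1 • d) := by rwa [one_smul]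
  have e1 := awayLift_mk 𝒜 φ hu hf hx'
  have e2 := awayLift_mk 𝒜 φ' hu' hf hx'
  rw [pow_one] at e1 e2
  rw [← e1, ← e2, h3]
  ring

lemma Represents.comp_toSpecZero {e : T ⟶ Proj 𝒜} {φ : A →+* Γ(T, ⊤)} (H : Represents 𝒜 e φ) :
    e ≫ Proj.toSpecZero 𝒜 =
      T.toSpecΓ ≫ Spec.map (CommRingCat.ofHom (φ.comp (algebraMap (𝒜 0) A))) := by
  refine Scheme.hom_ext_of_forall _ _ fun x => ?_
  obtain ⟨d, f, h0, hf, hx⟩ := H.exists_mem x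
  refine ⟨_, hx, ?_⟩
  have hu : IsUnit ((T.basicOpen (φ f)).ι.appTop.hom.comp φ f) := isUnit_ι_appTop _ le_rfl
  rw [← Category.assoc, H.comp_eq _ hf h0 hu, toProj, Category.assoc, Category.assoc,
    Proj.awayι_toSpecZero, ← Spec.map_comp, Scheme.toSpecΓ_naturality_assoc, ← Spec.map_comp]
  congr 2
  ext a
  have hx : (a : A) ∈ 𝒜 (0 • d) := by rw [zero_smul]; exact a.2
  have := awayLift_mk 𝒜 _ hu hf hx
  rw [pow_zero, mul_one] at this
  refine Eq.trans ?_ this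
  refine congrArg (awayLift 𝒜 _ hu) ?_
  apply HomogeneousLocalization.val_injective
  rw [Away.val_mk]
  simp only [pow_zero]
  rfl

end Represents

/-! ### Homogeneous coordinates of morphisms to projective space. -/

section Coordinates

attribute [local instance] MvPolynomial.gradedAlgebra

open MvPolynomial

lemma eval₂_mul_of_mem {ι R B : Type*} [CommSemiring R] [CommSemiring B] (r : R →+* B) (c : B)
    (w : ι → B) {n : ℕ} {x : MvPolynomial ι R} (hx : x ∈ homogeneousSubmodule ι R n) :
    eval₂ r (fun i => c * w i) x = c ^ n * eval₂ r w x := by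
  rw [eval₂_eq, eval₂_eq, Finset.mul_sum]
  refine Finset.sum_congr rfl fun d hd => ?_
  have h : d.degree = n := by
    by_contra h
    exact (mem_support_iff.1 hd) (IsHomogeneous.coeff_eq_zero hx h)
  rw [← h, Finsupp.degree_apply]
  simp_rw [mul_pow]
  rw [Finset.prod_mul_distrib, Finset.prod_pow_eq_pow_sum]
  ring

lemma X_mem_homogeneousSubmodule {ι R : Type*} [CommSemiring R] (i : ι) :
    (X i : MvPolynomial ι R) ∈ homogeneousSubmodule ι R 1 := isHomogeneous_X R i

variable {R : Type u} [CommRing R] {n : ℕ} {T T' : Scheme.{u}}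

/-- The morphism `e : T ⟶ Proj R[X₀, …, Xₙ]` is given by homogeneous coordinates `w`, and the
`R`-scheme structure on `T` is given by `r`. -/
def HasCoords (e : T ⟶ Proj (homogeneousSubmodule (Fin (n + 1)) R)) (r : R →+* Γ(T, ⊤))
    (w : Fin (n + 1) → Γ(T, ⊤)) : Prop :=
  Represents (homogeneousSubmodule (Fin (n + 1)) R) e (eval₂Hom r w)

lemma hasCoords_congr {e : T ⟶ Proj (homogeneousSubmodule (Fin (n + 1)) R)} {r r' : R →+* Γ(T, ⊤)}
    {w w' : Fin (n + 1) → Γ(T, ⊤)} (H : HasCoords e r w) (hr : r = r') (hw : w = w') :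
    HasCoords e r' w' := hr ▸ hw ▸ H

variable {e e' : T ⟶ Proj (homogeneousSubmodule (Fin (n + 1)) R)} {r : R →+* Γ(T, ⊤)}
  {w w' : Fin (n + 1) → Γ(T, ⊤)}

lemma appTop_comp_eval₂Hom (h : T' ⟶ T) : h.appTop.hom.comp (eval₂Hom r w) =
    eval₂Hom (h.appTop.hom.comp r) (fun i => h.appTop.hom (w i)) := by
  ext <;> simp

lemma HasCoords.comp (H : HasCoords e r w) (h : T' ⟶ T) :
    HasCoords (h ≫ e) (h.appTop.hom.comp r) (fun i => h.appTop.hom (w i)) := by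
  have := Represents.comp H h
  rwa [appTop_comp_eval₂Hom] at this

lemma HasCoords.of_forall_exists (H : ∀ x : T, ∃ U : T.Opens, x ∈ U ∧
    HasCoords (U.ι ≫ e) (U.ι.appTop.hom.comp r) (fun i => U.ι.appTop.hom (w i))) :
    HasCoords e r w := by
  refine Represents.of_forall_exists fun x => ?_
  obtain ⟨U, hx, hU⟩ := H x
  refine ⟨U, hx, ?_⟩
  rwa [appTop_comp_eval₂Hom]

lemma HasCoords.ext (H : HasCoords e r w) (H' : HasCoords e' r w) : e = e' :=
  Represents.ext H H'

lemma HasCoords.mul (H : HasCoords e r w) {c : Γ(T, ⊤)} (hc : IsUnit c) :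
    HasCoords e r (fun i => c * w i) :=
  Represents.of_scale H hc fun _ _ hf => eval₂_mul_of_mem r c w hf

lemma HasCoords.mem_basicOpen_iff (H : HasCoords e r w) (i : Fin (n + 1)) (x : T) :
    x ∈ T.basicOpen (w i) ↔ e x ∈ Proj.basicOpen (homogeneousSubmodule (Fin (n + 1)) R) (X i) := by
  have := Represents.mem_basicOpen_iff H (X_mem_homogeneousSubmodule i) one_pos x
  rwa [coe_eval₂Hom, eval₂_X] at this

lemma HasCoords.mul_eq_mul (H : HasCoords e r w) (H' : HasCoords e r w') {j : Fin (n + 1)}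
    (hu : IsUnit (w j)) (hu' : IsUnit (w' j)) (i : Fin (n + 1)) : w i * w' j = w' i * w j := by
  have := Represents.mul_eq_mul H H' (X_mem_homogeneousSubmodule j) one_pos
    (by rwa [coe_eval₂Hom, eval₂_X]) (by rwa [coe_eval₂Hom, eval₂_X])
    (X_mem_homogeneousSubmodule i)
  simpa only [coe_eval₂Hom, eval₂_X] using this

lemma adjoin_range_X_eq_top (ι R : Type*) [CommRing R] :
    Algebra.adjoin (homogeneousSubmodule ι R 0) (Set.range (X : ι → MvPolynomial ι R)) = ⊤ := by
  rw [eq_top_iff]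
  intro x _
  induction x using MvPolynomial.induction_on with
  | C a => exact Subalgebra.algebraMap_mem _ (⟨C a, isHomogeneous_C _ a⟩ : homogeneousSubmodule ι R 0)
  | add p q hp hq => exact add_mem (hp trivial) (hq trivial)
  | mul_X p i hp => exact mul_mem (hp trivial) (Algebra.subset_adjoin ⟨i, rfl⟩)

lemma exists_mem_basicOpen_X (x : Proj (homogeneousSubmodule (Fin (n + 1)) R)) :
    ∃ i, x ∈ Proj.basicOpen (homogeneousSubmodule (Fin (n + 1)) R) (X i) := by
  have := Proj.iSup_basicOpen_eq_top' (homogeneousSubmodule (Fin (n + 1)) R) X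
    (fun i => ⟨1, X_mem_homogeneousSubmodule i⟩) (adjoin_range_X_eq_top _ _)
  exact TopologicalSpace.Opens.mem_iSup.1 (this.ge (trivial : x ∈ (⊤ : Set _)))

lemma exists_hasCoords (r : R →+* Γ(T, ⊤)) (w : Fin (n + 1) → Γ(T, ⊤))
    (H : ∀ x : T, ∃ i, x ∈ T.basicOpen (w i)) :
    ∃ e : T ⟶ Proj (homogeneousSubmodule (Fin (n + 1)) R), HasCoords e r w :=
  exists_represents _ fun x => by
    obtain ⟨i, hi⟩ := H x
    exact ⟨1, X i, one_pos, X_mem_homogeneousSubmodule i, by rwa [coe_eval₂Hom, eval₂_X]⟩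

/-- The structure morphism of projective space over a commutative ring. -/
def projStr (n : ℕ) (R : Type u) [CommRing R] : Proj (homogeneousSubmodule (Fin (n + 1)) R) ⟶ Spec (CommRingCat.of R) :=
  Proj.toSpecZero (homogeneousSubmodule (Fin (n + 1)) R) ≫
    Spec.map (CommRingCat.ofHom (algebraMap R (homogeneousSubmodule (Fin (n + 1)) R 0)))

lemma HasCoords.comp_projStr (H : HasCoords e r w) :
    e ≫ projStr n R = T.toSpecΓ ≫ Spec.map (CommRingCat.ofHom r) := by
  rw [projStr, ← Category.assoc, Represents.comp_toSpecZero H, Category.assoc, ← Spec.map_comp]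
  congr 2
  ext a
  exact eval₂_C r w a

lemma awayι_projStr (j : Fin (n + 1)) :
    Proj.awayι (homogeneousSubmodule (Fin (n + 1)) R) (X j) (X_mem_homogeneousSubmodule j) one_pos ≫
      projStr n R = Spec.map (CommRingCat.ofHom ((fromZeroRingHom _ _).comp
        (algebraMap R (homogeneousSubmodule (Fin (n + 1)) R 0)))) := by
  rw [projStr, Proj.awayι_toSpecZero_assoc, ← Spec.map_comp]
  rfl

/-- The coordinate `Xᵢ/Xⱼ`. -/
def ratio (R : Type u) [CommRing R] (j i : Fin (n + 1)) :
    Away (homogeneousSubmodule (Fin (n + 1)) R) (X j : MvPolynomial (Fin (n + 1)) R) :=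
  Away.mk _ (X_mem_homogeneousSubmodule j) 1 (X i) (X_mem_homogeneousSubmodule i)

/-- Dehomogenization: substituting `Xᵢ / Xⱼ` into a form of degree `m` divides it by `Xⱼᵐ`. It is
checked after multiplying by that power in the localization. -/
lemma eval₂_ratio (j : Fin (n + 1)) (m : ℕ) (x : MvPolynomial (Fin (n + 1)) R)
    (hx : x ∈ homogeneousSubmodule (Fin (n + 1)) R (m • 1)) :
    eval₂ ((fromZeroRingHom _ _).comp
      (algebraMap R (homogeneousSubmodule (Fin (n + 1)) R 0))) (ratio R j) x =
      Away.mk (homogeneousSubmodule (Fin (n + 1)) R) (X_mem_homogeneousSubmodule j) m x hx := by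
  apply HomogeneousLocalization.val_injective
  let S := Localization.Away (X j : MvPolynomial (Fin (n + 1)) R)
  let v := algebraMap (Away (homogeneousSubmodule (Fin (n + 1)) R)
    (X j : MvPolynomial (Fin (n + 1)) R)) S
  let c : S := algebraMap (MvPolynomial (Fin (n + 1)) R) S (X j)
  have hc : IsUnit c := IsLocalization.Away.algebraMap_isUnit _
  have key : ∀ (m : ℕ) (x : MvPolynomial (Fin (n + 1)) R)
      (hx : x ∈ homogeneousSubmodule (Fin (n + 1)) R (m • 1)),
      c ^ m * v (Away.mk _ (X_mem_homogeneousSubmodule j) m x hx) = algebraMap _ S x := by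
    intro m x hx
    rw [mul_comm, HomogeneousLocalization.algebraMap_apply, Away.val_mk, Localization.mk_eq_mk']
    have := IsLocalization.mk'_spec S x
      (⟨X j ^ m, ⟨m, rfl⟩⟩ : Submonoid.powers (X j : MvPolynomial (Fin (n + 1)) R))
    rwa [map_pow] at this
  refine (hc.pow m).mul_right_injective ((Eq.trans ?_ (key m x hx).symm :))
  change c ^ m * v _ = _
  rw [MvPolynomial.hom_eval₂, ← eval₂_mul_of_mem _ _ _ (show x ∈ _ by simpa using hx)]
  have h1 : (fun i => c * v (ratio R j i)) = fun i => algebraMap (MvPolynomial (Fin (n + 1)) R) S (X i) := by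
    funext i
    have := key 1 (X i) (X_mem_homogeneousSubmodule i)
    rwa [pow_one] at this
  have h2 : v.comp ((fromZeroRingHom _ _).comp
      (algebraMap R (homogeneousSubmodule (Fin (n + 1)) R 0))) =
      (algebraMap (MvPolynomial (Fin (n + 1)) R) S).comp C := by
    ext a
    exact HomogeneousLocalization.val_mk _
  refine (congrArg (fun f => eval₂ _ f x) h1).trans ?_
  rw [h2, ← MvPolynomial.hom_eval₂, eval₂_eta]

/-- A morphism into the affine chart `D₊(Xⱼ)` is a ring homomorphism; the images of `Xᵢ / Xⱼ` are
coordinates normalized by `wⱼ = 1`. -/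
lemma exists_hasCoords_of_forall_mem (hr : e ≫ projStr n R =
      T.toSpecΓ ≫ Spec.map (CommRingCat.ofHom r)) {j : Fin (n + 1)}
    (hj : ∀ x, e x ∈ Proj.basicOpen (homogeneousSubmodule (Fin (n + 1)) R) (X j)) :
    ∃ w : Fin (n + 1) → Γ(T, ⊤), w j = 1 ∧ HasCoords e r w := by
  let ι := Proj.awayι (homogeneousSubmodule (Fin (n + 1)) R) (X j)
    (X_mem_homogeneousSubmodule j) one_pos
  have hι : Set.range e ⊆ Set.range ι := by
    rintro _ ⟨x, rfl⟩
    have := hj x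
    rw [← Proj.opensRange_awayι _ _ (X_mem_homogeneousSubmodule j) one_pos] at this
    exact this
  let f := IsOpenImmersion.lift ι e hι
  have hf : f ≫ ι = e := IsOpenImmersion.lift_fac _ _ _
  let ψ := sectionsHom f
  have hψ : T.toSpecΓ ≫ Spec.map (CommRingCat.ofHom ψ) = f := toSpecΓ_SpecMap_sectionsHom f
  have h1 : ψ.comp ((fromZeroRingHom _ _).comp
      (algebraMap R (homogeneousSubmodule (Fin (n + 1)) R 0))) = r := by
    apply toSpecΓ_SpecMap_injective
    rw [← hr, CommRingCat.ofHom_comp, Spec.map_comp, ← awayι_projStr, ← Category.assoc, hψ,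
      ← Category.assoc, hf]
  have h2 : ψ (ratio R j j) = 1 := by
    have : ratio R j j = 1 := by
      apply HomogeneousLocalization.val_injective
      rw [ratio, Away.val_mk, val_one, Localization.mk_eq_mk']
      simp only [pow_one]
      exact IsLocalization.mk'_self' (M := Submonoid.powers (X j : MvPolynomial _ R)) _
        (x := ⟨X j, ⟨1, pow_one _⟩⟩)
    rw [this, map_one]
  have hu : IsUnit (eval₂Hom r (fun i => ψ (ratio R j i)) (X j)) := by
    rw [coe_eval₂Hom, eval₂_X, h2]; exact isUnit_one
  refine ⟨fun i => ψ (ratio R j i), h2, ?_⟩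
  have h3 : ψ = awayLift (homogeneousSubmodule (Fin (n + 1)) R) _ hu := by
    refine eq_awayLift _ _ hu (X_mem_homogeneousSubmodule j) _ fun m x hx => ?_
    rw [coe_eval₂Hom, eval₂_X, h2, one_pow, mul_one, ← eval₂_ratio j m x hx,
      MvPolynomial.hom_eval₂, h1]
  have h4 := represents_toProj (𝒜 := homogeneousSubmodule (Fin (n + 1)) R) _
    (X_mem_homogeneousSubmodule j) one_pos hu
  rwa [toProj, ← h3, ← Category.assoc, hψ, hf] at h4

/-- Where `wⱼ` and `w'ⱼ` are both invertible, the unit is `w'ⱼ / wⱼ`. -/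
lemma HasCoords.exists_eq_mul (H : HasCoords e r w) (H' : HasCoords e r w') (x : T) :
    ∃ U : T.Opens, x ∈ U ∧ ∃ c : Γ(U, ⊤), IsUnit c ∧
      ∀ i, U.ι.appTop.hom (w' i) = c * U.ι.appTop.hom (w i) := by
  obtain ⟨j, hj⟩ := exists_mem_basicOpen_X (e x)
  let U := T.basicOpen (w j) ⊓ T.basicOpen (w' j)
  have hu : IsUnit (U.ι.appTop.hom (w j)) := isUnit_ι_appTop _ inf_le_left
  have hu' : IsUnit (U.ι.appTop.hom (w' j)) := isUnit_ι_appTop _ inf_le_right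
  refine ⟨U, ⟨(H.mem_basicOpen_iff j x).2 hj, (H'.mem_basicOpen_iff j x).2 hj⟩,
    U.ι.appTop.hom (w' j) * ↑hu.unit⁻¹, hu'.mul hu.unit⁻¹.isUnit, fun i => ?_⟩
  have := (H.comp U.ι).mul_eq_mul (H'.comp U.ι) hu hu' i
  apply hu.mul_left_injective
  simp only
  rw [← this, mul_right_comm, mul_assoc _ _ (U.ι.appTop.hom (w j)), hu.val_inv_mul]
  ring

lemma exists_hasCoords_ι (hr : e ≫ projStr n R = T.toSpecΓ ≫ Spec.map (CommRingCat.ofHom r))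
    (x : T) : ∃ (U : T.Opens) (w : Fin (n + 1) → Γ(U, ⊤)) (j : Fin (n + 1)), x ∈ U ∧ w j = 1 ∧
      HasCoords (U.ι ≫ e) (U.ι.appTop.hom.comp r) w := by
  obtain ⟨j, hj⟩ := exists_mem_basicOpen_X (e x)
  let U := e ⁻¹ᵁ Proj.basicOpen (homogeneousSubmodule (Fin (n + 1)) R) (X j)
  obtain ⟨w, h1, h2⟩ := exists_hasCoords_of_forall_mem (e := U.ι ≫ e)
    (r := U.ι.appTop.hom.comp r) (j := j)
    (by rw [Category.assoc, hr, Scheme.toSpecΓ_naturality_assoc, ← Spec.map_comp]; rfl)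
    (fun x => x.2)
  exact ⟨U, w, j, hj, h1, h2⟩

end Coordinates

end

/-! ### The norm form and its coefficients. -/

section

open MvPolynomial

/-- Distinct embeddings are linearly independent over `S`, so the rows of the matrix `(τ(a_i))` are
independent and it has a right inverse `b`. No equality between the number of embeddings and the
degree is needed. -/
lemma exists_dual_embeddings {k K S ι : Type*} [Field k] [Field K] [Field S] [Algebra k K]
    [Algebra k S] [FiniteDimensional k K] [Fintype ι] (a : Module.Basis ι k K)
    [DecidableEq (K →ₐ[k] S)] : ∃ b : ι → (K →ₐ[k] S) → S,
      ∀ τ ρ : K →ₐ[k] S, ∑ i, τ (a i) * b i ρ = if τ = ρ then 1 else 0 := by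
  classical
  have hli : LinearIndependent S (fun (τ : K →ₐ[k] S) (i : ι) => τ (a i)) := by
    rw [Fintype.linearIndependent_iff]
    intro c hc
    refine Fintype.linearIndependent_iff.1 (linearIndependent_toLinearMap k K S) c ?_
    refine a.ext fun i => ?_
    have := congrFun hc i
    simpa [LinearMap.sum_apply, Finset.sum_apply] using this
  obtain ⟨g, hg⟩ := LinearMap.exists_leftInverse_of_injective
    (Fintype.linearCombination S (fun (τ : K →ₐ[k] S) (i : ι) => τ (a i)))
    (LinearMap.ker_eq_bot.2 (LinearIndependent.fintypeLinearCombination_injective hli))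
  refine ⟨fun i ρ => g (Pi.single i 1) ρ, fun τ ρ => ?_⟩
  have h1 := congrFun (LinearMap.congr_fun hg (Pi.single τ 1)) ρ
  rw [LinearMap.comp_apply, Fintype.linearCombination_apply_single, one_smul] at h1
  have h2 : (fun i => τ (a i)) = ∑ i, τ (a i) • (Pi.single i 1 : ι → S) := by
    funext j
    simp [Finset.sum_apply, Pi.single_apply]
  rw [h2, map_sum, Finset.sum_apply] at h1
  simp only [map_smul, Pi.smul_apply, smul_eq_mul, LinearMap.id_apply, Pi.single_apply] at h1
  rw [h1]
  simp only [eq_comm]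

lemma prod_sum_C_mul_X {I ι B : Type*} [Fintype I] [DecidableEq I] [Fintype ι] [CommRing B]
    (y : I → ι → B) : ∏ τ, ∑ p, C (y τ p) * X p =
      ∑ g : I → ι, monomial (∑ τ, Finsupp.single (g τ) 1) (∏ τ, y τ (g τ)) := by
  classical
  rw [Finset.prod_univ_sum, Fintype.piFinset_univ]
  refine Finset.sum_congr rfl fun g _ => ?_
  rw [monomial_sum_index, map_prod, ← Finset.prod_mul_distrib]
  rfl

/-- Multilinear forms in the coordinates of the conjugates of a point of `ℙⁿ`, equivariant for
the automorphisms of `S`, whose `S`-span contains all products of coordinates. -/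
structure InvariantForms (k K S : Type u) [Field k] [Field K] [Field S] [Algebra k K] [Algebra k S]
    [FiniteDimensional k K] (n : ℕ) where
  /-- The number of forms, minus one. -/
  N : ℕ
  /-- The values of the forms. -/
  s {B : Type u} [CommRing B] (χ : S →+* B) (w : (K →ₐ[k] S) → Fin (n + 1) → B) : Fin (N + 1) → B
  map_s {B B' : Type u} [CommRing B] [CommRing B'] (f : B →+* B') (χ : S →+* B)
    (w : (K →ₐ[k] S) → Fin (n + 1) → B) (i : Fin (N + 1)) :
    f (s χ w i) = s (f.comp χ) (fun τ j => f (w τ j)) i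
  s_mul {B : Type u} [CommRing B] (χ : S →+* B) (w : (K →ₐ[k] S) → Fin (n + 1) → B)
    (c : (K →ₐ[k] S) → B) (i : Fin (N + 1)) :
    s χ (fun τ j => c τ * w τ j) i = (∏ τ, c τ) * s χ w i
  s_comp {B : Type u} [CommRing B] (χ : S →+* B) (w : (K →ₐ[k] S) → Fin (n + 1) → B)
    (ω : S ≃ₐ[k] S) :
    s (χ.comp (ω : S →+* S)) (fun τ => w ((ω : S →ₐ[k] S).comp τ)) = s χ w
  exists_sum_eq (m : (K →ₐ[k] S) → Fin (n + 1)) : ∃ L : Fin (N + 1) → S,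
    ∀ {B : Type u} [CommRing B] (χ : S →+* B) (w : (K →ₐ[k] S) → Fin (n + 1) → B),
      ∑ i, χ (L i) * s χ w i = ∏ τ, w τ (m τ)

section Forms

variable {k K S : Type u} [Field k] [Field K] [Field S] [Algebra k K] [Algebra k S]
    [FiniteDimensional k K] (n : ℕ)

/-- The norm form of the generic linear form with coefficients in `K`. -/
def normForm {B : Type u} [CommRing B] (χ : S →+* B) (w : (K →ₐ[k] S) → Fin (n + 1) → B) :
    MvPolynomial (Fin (Module.finrank k K) × Fin (n + 1)) B :=
  ∏ τ : K →ₐ[k] S, ∑ p : Fin (Module.finrank k K) × Fin (n + 1),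
    C (χ (τ (Module.finBasis k K p.1)) * w τ p.2) * X p

variable (k K S) in
/-- The exponents that occur in the norm form. -/
def normFormExponents : Finset (Fin (Module.finrank k K) × Fin (n + 1) →₀ ℕ) := by
  classical
  exact Finset.univ.image fun g : (K →ₐ[k] S) → _ => ∑ τ, Finsupp.single (g τ) 1

/-- The point is that the index set does not depend on `B`, `χ` or `w`, so the coefficients form a
family of fixed finite length. -/
lemma normForm_eq_sum {B : Type u} [CommRing B] (χ : S →+* B)
    (w : (K →ₐ[k] S) → Fin (n + 1) → B) : normForm n χ w =
      ∑ μ ∈ normFormExponents k K S n, monomial μ (coeff μ (normForm n χ w)) := by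
  classical
  conv_lhs => rw [(normForm n χ w).as_sum]
  refine Finset.sum_subset (fun μ hμ => ?_) fun μ _ hμ => ?_
  · rw [mem_support_iff, normForm, prod_sum_C_mul_X, coeff_sum] at hμ
    obtain ⟨g, _, hg⟩ := Finset.exists_ne_zero_of_sum_ne_zero hμ
    rw [coeff_monomial] at hg
    split_ifs at hg with h
    · exact Finset.mem_image.2 ⟨g, Finset.mem_univ _, h⟩
    · exact absurd rfl hg
  · rw [notMem_support_iff.1 hμ, monomial_zero]

/-- Substituting `X_{i,j} = ∑_ρ b_i(ρ) Y_{ρ,j}` with `b` dual to the embeddings turns the norm form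
into `∏_τ ∑_j w_{τ,j} Y_{τ,j}`. The coefficient of `∏_τ Y_{τ,m(τ)}` in it is the required product,
and it is an `S`-linear combination of the original coefficients. -/
lemma exists_sum_coeff_normForm_eq (m : (K →ₐ[k] S) → Fin (n + 1)) :
    ∃ L : (Fin (Module.finrank k K) × Fin (n + 1) →₀ ℕ) → S,
      ∀ {B : Type u} [CommRing B] (χ : S →+* B) (w : (K →ₐ[k] S) → Fin (n + 1) → B),
      ∑ μ ∈ normFormExponents k K S n, χ (L μ) * coeff μ (normForm n χ w) = ∏ τ, w τ (m τ) := by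
  classical
  obtain ⟨b, hb⟩ := exists_dual_embeddings (S := S) (Module.finBasis k K)
  let g : Fin (Module.finrank k K) × Fin (n + 1) → MvPolynomial ((K →ₐ[k] S) × Fin (n + 1)) S :=
    fun p => ∑ ρ, C (b p.1 ρ) * X (ρ, p.2)
  let ν : ((K →ₐ[k] S) × Fin (n + 1)) →₀ ℕ := ∑ τ, Finsupp.single (τ, m τ) 1
  refine ⟨fun μ => coeff ν (bind₁ g (monomial μ 1)), fun {B} _ χ w => ?_⟩
  let Φ := bind₁ fun p => map χ (g p)
  have hΦ : ∀ μ s, coeff ν (Φ (monomial μ s)) = χ (coeff ν (bind₁ g (monomial μ 1))) * s := by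
    intro μ s
    rw [← coeff_map, map_bind₁, map_monomial, map_one, mul_comm, ← coeff_C_mul]
    congr 1
    have : (monomial μ s : MvPolynomial _ B) = C s * monomial μ 1 := by
      rw [C_mul_monomial, mul_one]
    rw [this, map_mul]
    congr 1
    exact bind₁_C_right _ _
  have h1 : Φ (normForm n χ w) = ∏ τ, ∑ p : (K →ₐ[k] S) × Fin (n + 1),
      C (if p.1 = τ then w τ p.2 else 0) * X p := by
    rw [normForm, map_prod]
    refine Finset.prod_congr rfl fun τ _ => ?_
    rw [map_sum, Fintype.sum_prod_type_right, Fintype.sum_prod_type_right]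
    refine Finset.sum_congr rfl fun j _ => ?_
    have : ∀ i, Φ (C (χ (τ (Module.finBasis k K i)) * w τ j) * X (i, j)) =
        ∑ ρ, C (χ (τ (Module.finBasis k K i) * b i ρ) * w τ j) * X (ρ, j) := by
      intro i
      rw [map_mul]
      simp only [Φ, bind₁_C_right, bind₁_X_right, g, map_sum, map_mul, map_C, map_X, Finset.mul_sum]
      refine Finset.sum_congr rfl fun ρ _ => by ring
    simp only [this]
    rw [Finset.sum_comm]
    refine Finset.sum_congr rfl fun ρ _ => ?_
    rw [← Finset.sum_mul, ← map_sum C, ← Finset.sum_mul, ← map_sum χ, hb]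
    congr 2
    by_cases h : τ = ρ
    · subst h; simp
    · rw [if_neg h, if_neg (Ne.symm h)]; simp
  have h2 := congrArg (fun q => coeff ν (Φ q)) (normForm_eq_sum n χ w)
  simp only [map_sum, coeff_sum, hΦ] at h2
  rw [← h2, h1, prod_sum_C_mul_X, coeff_sum, Finset.sum_eq_single (fun τ => (τ, m τ))]
  · rw [coeff_monomial, if_pos rfl]
    simp
  · intro f _ hf
    rw [coeff_monomial]
    split_ifs with h
    -- A nonzero contribution forces `f τ` to lie in block `τ`; equality of exponents then leaves
    -- only `f τ = (τ, m τ)`.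
    · by_contra hne
      have h3 : ∀ τ, (f τ).1 = τ := fun τ => by
        by_contra h4
        exact hne (Finset.prod_eq_zero (Finset.mem_univ τ) (if_neg h4))
      refine hf (funext fun τ => Prod.ext (h3 τ) ?_)
      have h5 := DFunLike.congr_fun h (f τ)
      rw [Finsupp.finsetSum_apply, Finsupp.finsetSum_apply] at h5
      have h6 : ∑ x, (Finsupp.single (f x) 1 : (K →ₐ[k] S) × Fin (n + 1) →₀ ℕ) (f τ) ≠ 0 := by
        refine (Finset.sum_pos' (fun _ _ => Nat.zero_le _) ⟨τ, Finset.mem_univ _, ?_⟩).ne'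
        simp
      rw [h5] at h6
      obtain ⟨x, _, hx⟩ := Finset.exists_ne_zero_of_sum_ne_zero h6
      rw [Finsupp.single_apply] at hx
      split_ifs at hx with h7
      · have h8 := congrArg Prod.fst h7
        rw [h3] at h8
        simp only at h8
        subst h8
        rw [← h7]
      · exact absurd rfl hx
    · rfl
  · exact fun h => absurd (Finset.mem_univ _) h

variable (k K S) in
lemma nonempty_invariantForms : Nonempty (InvariantForms k K S n) := by
  classical
  let M := normFormExponents k K S n
  have : Nonempty (Fin (Module.finrank k K)) := ⟨⟨0, Module.finrank_pos⟩⟩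
  have hM : M.Nonempty := Finset.univ_nonempty.image _
  let ε : Fin (M.card - 1 + 1) ≃ M :=
    (finCongr (Nat.sub_add_cancel hM.card_pos)).trans M.equivFin.symm
  -- The forms are indexed by `Fin (N + 1)`, so `N` is one less than the number of exponents, which
  -- is positive because `K ≠ 0`.
  refine ⟨⟨M.card - 1, fun χ w i => coeff (ε i : _ →₀ ℕ) (normForm n χ w), ?_, ?_, ?_, ?_⟩⟩
  · intro B B' _ _ f χ w i
    rw [← coeff_map]
    congr 1
    simp [normForm, map_prod, map_sum]
  · intro B _ χ w c i
    rw [← coeff_C_mul]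
    congr 1
    rw [normForm, normForm, map_prod, ← Finset.prod_mul_distrib]
    refine Finset.prod_congr rfl fun τ _ => ?_
    rw [Finset.mul_sum]
    refine Finset.sum_congr rfl fun p _ => ?_
    simp only [map_mul]
    ring
  · intro B _ χ w ω
    funext i
    refine congrArg (coeff _) ?_
    -- Acting by `ω` on scalars and conjugates permutes the factors of the norm by `τ ↦ ωτ`.
    exact Fintype.prod_equiv (AlgEquiv.refl.arrowCongr ω) _ _ fun τ => rfl
  · intro m
    obtain ⟨L, hL⟩ := exists_sum_coeff_normForm_eq (k := k) (K := K) (S := S) n m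
    refine ⟨fun i => L (ε i), fun χ w => ?_⟩
    rw [← hL χ w, ← Finset.sum_coe_sort (normFormExponents k K S n)]
    exact Fintype.sum_equiv ε _ _ fun i => rfl

end Forms

end

/-! ### The invariant morphism to projective space over `k`. -/

section

open MvPolynomial

lemma exists_opens_le_of_finite {T : Scheme.{u}} {I : Type*} [Finite I] (U : I → T.Opens) {x : T}
    (hx : ∀ i, x ∈ U i) : ∃ W : T.Opens, x ∈ W ∧ ∀ i, W ≤ U i :=
  ⟨⟨⋂ i, U i, isOpen_iInter_of_finite fun i => (U i).2⟩, Set.mem_iInter.2 hx,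
    fun i => Set.iInter_subset _ i⟩

lemma exists_mem_basicOpen_of_sum {T : Scheme.{u}} {I : Type*} [Fintype I] {a b : I → Γ(T, ⊤)}
    {x : T} (h : x ∈ T.basicOpen (∑ i, a i * b i)) : ∃ i, x ∈ T.basicOpen (b i) := by
  rw [Scheme.mem_basicOpen_top, map_sum] at h
  obtain ⟨i, -, hi⟩ := IsLocalRing.exists_of_isUnit_sum h
  refine ⟨i, ?_⟩
  rw [map_mul] at hi
  rw [Scheme.mem_basicOpen_top]
  exact isUnit_of_mul_isUnit_right hi

lemma mem_basicOpen_prod {T : Scheme.{u}} {I : Type*} (s : Finset I) {a : I → Γ(T, ⊤)}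
    {x : T} (h : ∀ i ∈ s, x ∈ T.basicOpen (a i)) : x ∈ T.basicOpen (∏ i ∈ s, a i) := by
  simp only [Scheme.mem_basicOpen_top] at h ⊢
  rw [map_prod]
  exact IsUnit.prod_iff.2 h

section Conjugates

attribute [local instance] MvPolynomial.gradedAlgebra

variable {k K S : Type u} [Field k] [Field K] [Field S] [Algebra k K] [Algebra k S]
  {n : ℕ} {V X : Scheme.{u}}
  (e : V ⟶ Proj (homogeneousSubmodule (Fin (n + 1)) K))
  (str : X ⟶ Spec (CommRingCat.of S)) (p : (K →ₐ[k] S) → (X ⟶ V))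

/-- Homogeneous coordinates for the conjugates `p τ : X ⟶ V ⟶ ℙⁿ` of a point `h` of `X`. -/
def ConjCoords {T : Scheme.{u}} (h : T ⟶ X) (w : (K →ₐ[k] S) → Fin (n + 1) → Γ(T, ⊤)) : Prop :=
  ∀ τ, HasCoords (h ≫ p τ ≫ e) ((sectionsHom (h ≫ str)).comp (τ : K →+* S)) (w τ)

variable {e str p} {T T' : Scheme.{u}}

lemma ConjCoords.comp {h : T ⟶ X} {w : (K →ₐ[k] S) → Fin (n + 1) → Γ(T, ⊤)}
    (H : ConjCoords e str p h w) (g : T' ⟶ T) :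
    ConjCoords e str p (g ≫ h) (fun τ j => g.appTop.hom (w τ j)) := fun τ => by
  have := (H τ).comp g
  rw [Category.assoc, Category.assoc, sectionsHom_comp]
  exact this

variable [FiniteDimensional k K]

lemma exists_conjCoords
    (hp : ∀ τ, p τ ≫ e ≫ projStr n K = str ≫ Spec.map (CommRingCat.ofHom (τ : K →+* S))) (x : X) :
    ∃ (U : X.Opens) (w : (K →ₐ[k] S) → Fin (n + 1) → Γ(U, ⊤)), x ∈ U ∧
      ConjCoords e str p U.ι w := by
  have H : ∀ τ, ∃ (U : X.Opens) (w : Fin (n + 1) → Γ(U, ⊤)) (j : Fin (n + 1)), x ∈ U ∧ w j = 1 ∧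
      HasCoords (U.ι ≫ p τ ≫ e) (U.ι.appTop.hom.comp ((sectionsHom str).comp (τ : K →+* S))) w := by
    intro τ
    refine exists_hasCoords_ι ?_ x
    rw [Category.assoc, hp, CommRingCat.ofHom_comp, Spec.map_comp, ← Category.assoc,
      toSpecΓ_SpecMap_sectionsHom]
  choose U w j hx _ hw using H
  obtain ⟨W, hxW, hW⟩ := exists_opens_le_of_finite U hx
  refine ⟨W, fun τ i => (X.homOfLE (hW τ)).appTop.hom (w τ i), hxW, fun τ => ?_⟩
  have := (hw τ).comp (X.homOfLE (hW τ))
  rw [Scheme.homOfLE_ι_assoc, appTop_comp_appTop_comp, Scheme.homOfLE_ι, ← RingHom.comp_assoc,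
    ← sectionsHom_comp] at this
  exact this

variable (Φ : InvariantForms k K S n)

/-- Choose for each `τ` a coordinate nonzero at `x`. Their product is nonzero at `x` and is a linear
combination of the forms, so the forms have no common zero. -/
lemma ConjCoords.exists_mem {h : T ⟶ X} {w : (K →ₐ[k] S) → Fin (n + 1) → Γ(T, ⊤)}
    (H : ConjCoords e str p h w) (x : T) :
    ∃ i, x ∈ T.basicOpen (Φ.s (sectionsHom (h ≫ str)) w i) := by
  have h1 : ∀ τ, ∃ j, x ∈ T.basicOpen (w τ j) := fun τ => by
    obtain ⟨j, hj⟩ := exists_mem_basicOpen_X ((h ≫ p τ ≫ e) x)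
    exact ⟨j, ((H τ).mem_basicOpen_iff j x).2 hj⟩
  choose m hm using h1
  obtain ⟨L, hL⟩ := Φ.exists_sum_eq m
  refine exists_mem_basicOpen_of_sum (a := fun i => sectionsHom (h ≫ str) (L i)) ?_
  rw [hL]
  exact mem_basicOpen_prod _ fun τ _ => hm τ

/-- Locally the coordinates of the conjugates change by units `c_τ`, and by multilinearity all forms
change by the common unit `∏_τ c_τ`. -/
lemma ConjCoords.hasCoords_of_hasCoords {h : T ⟶ X} {w w' : (K →ₐ[k] S) → Fin (n + 1) → Γ(T, ⊤)}
    (H : ConjCoords e str p h w) (H' : ConjCoords e str p h w') {r : k →+* Γ(T, ⊤)}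
    {f : T ⟶ Proj (homogeneousSubmodule (Fin (Φ.N + 1)) k)}
    (hf : HasCoords f r (Φ.s (sectionsHom (h ≫ str)) w)) :
    HasCoords f r (Φ.s (sectionsHom (h ≫ str)) w') := by
  refine .of_forall_exists fun x => ?_
  choose U hxU c hc hU using fun τ => (H τ).exists_eq_mul (H' τ) x
  obtain ⟨W, hxW, hW⟩ := exists_opens_le_of_finite U hxU
  refine ⟨W, hxW, ?_⟩
  let c' := fun τ => (T.homOfLE (hW τ)).appTop.hom (c τ)
  have hc' : ∀ τ, IsUnit (c' τ) := fun τ => (hc τ).map _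
  have h1 : (fun τ j => W.ι.appTop.hom (w' τ j)) = fun τ j => c' τ * W.ι.appTop.hom (w τ j) := by
    funext τ j
    have := congrArg (T.homOfLE (hW τ)).appTop.hom (hU τ j)
    rw [map_mul, ← RingHom.comp_apply, ← RingHom.comp_apply, ← CommRingCat.hom_comp,
      ← Scheme.Hom.comp_appTop, Scheme.homOfLE_ι] at this
    exact this
  refine hasCoords_congr ((hf.comp W.ι).mul (IsUnit.prod_univ_iff.2 hc')) rfl ?_
  funext i
  rw [Φ.map_s, Φ.map_s, h1, Φ.s_mul]

variable (e str p) in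
/-- The morphism `f : X ⟶ ℙᴺ` is given by the invariant forms in the coordinates of the
conjugates. -/
def IsInvariantMap (f : X ⟶ Proj (homogeneousSubmodule (Fin (Φ.N + 1)) k)) : Prop :=
  ∀ {T : Scheme.{u}} (h : T ⟶ X) (w : (K →ₐ[k] S) → Fin (n + 1) → Γ(T, ⊤)),
    ConjCoords e str p h w → HasCoords (h ≫ f) ((sectionsHom (h ≫ str)).comp (algebraMap k S))
      (Φ.s (sectionsHom (h ≫ str)) w)

lemma exists_isInvariantMap
    (hp : ∀ τ, p τ ≫ e ≫ projStr n K = str ≫ Spec.map (CommRingCat.ofHom (τ : K →+* S))) :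
    ∃ f, IsInvariantMap e str p Φ f := by
  choose U w hx hw using exists_conjCoords hp
  choose f hf using fun x => exists_hasCoords (R := k)
    ((sectionsHom ((U x).ι ≫ str)).comp (algebraMap k S)) _ ((hw x).exists_mem Φ)
  have key : ∀ (x y : X) {T : Scheme.{u}} (g₁ : T ⟶ U x) (g₂ : T ⟶ U y),
      g₁ ≫ (U x).ι = g₂ ≫ (U y).ι → g₁ ≫ f x = g₂ ≫ f y := by
    intro x y T g₁ g₂ hg
    have h1 := (hf x).comp g₁
    have h2 := (hf y).comp g₂
    simp only [Φ.map_s] at h1 h2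
    rw [← RingHom.comp_assoc, ← sectionsHom_comp, ← Category.assoc] at h1 h2
    have h3 := (hw x).comp g₁
    have h4 := (hw y).comp g₂
    rw [hg] at h1 h3
    exact (h3.hasCoords_of_hasCoords Φ h4 h1).ext h2
  have hU : TopologicalSpace.IsOpenCover U := by
    rw [TopologicalSpace.IsOpenCover, ← top_le_iff]
    exact fun x _ => TopologicalSpace.Opens.mem_iSup.2 ⟨x, hx x⟩
  let 𝒰 : X.OpenCover := X.openCoverOfIsOpenCover U hU
  let F := 𝒰.glueMorphisms f (fun x y => key x y _ _ pullback.condition)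
  have hF : ∀ x, (U x).ι ≫ F = f x := fun x => 𝒰.ι_glueMorphisms _ _ x
  refine ⟨F, fun {T} h w' hw' => .of_forall_exists fun x => ?_⟩
  let W := h ⁻¹ᵁ (U (h x))
  let g : W.toScheme ⟶ U (h x) := h ∣_ (U (h x))
  have hg : g ≫ (U (h x)).ι = W.ι ≫ h := morphismRestrict_ι h _
  refine ⟨W, hx (h x), ?_⟩
  have h1 := (hf (h x)).comp g
  simp only [Φ.map_s] at h1 ⊢
  rw [← RingHom.comp_assoc, ← sectionsHom_comp] at h1 ⊢
  rw [← hF, ← Category.assoc, ← Category.assoc, hg] at h1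
  rw [← Category.assoc, ← Category.assoc]
  have h3 := (hw (h x)).comp g
  rw [hg] at h3
  exact h3.hasCoords_of_hasCoords Φ (hw'.comp W.ι) h1

variable {Φ}

lemma IsInvariantMap.comp_projStr {f : X ⟶ Proj (homogeneousSubmodule (Fin (Φ.N + 1)) k)}
    (hf : IsInvariantMap e str p Φ f)
    (hp : ∀ τ, p τ ≫ e ≫ projStr n K = str ≫ Spec.map (CommRingCat.ofHom (τ : K →+* S))) :
    f ≫ projStr Φ.N k = str ≫ specAlg k S := by
  refine Scheme.hom_ext_of_forall _ _ fun x => ?_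
  obtain ⟨U, w, hx, hw⟩ := exists_conjCoords hp x
  refine ⟨U, hx, ?_⟩
  rw [← Category.assoc, (hf U.ι w hw).comp_projStr, CommRingCat.ofHom_comp, Spec.map_comp,
    ← Category.assoc, toSpecΓ_SpecMap_sectionsHom, Category.assoc]

/-- Coordinates of `p (ωτ)` at a point serve as coordinates of `p τ` at its image under `a`.
Equivariance of the forms absorbs this relabelling together with the twist by `ω` of the structure
map. -/
lemma IsInvariantMap.comp_eq {f : X ⟶ Proj (homogeneousSubmodule (Fin (Φ.N + 1)) k)}
    (hf : IsInvariantMap e str p Φ f)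
    (hp : ∀ τ, p τ ≫ e ≫ projStr n K = str ≫ Spec.map (CommRingCat.ofHom (τ : K →+* S)))
    {ω : S ≃ₐ[k] S} {a : X ⟶ X} (ha : a ≫ str = str ≫ specAut ω)
    (hap : ∀ τ, a ≫ p τ = p ((ω : S →ₐ[k] S).comp τ)) : a ≫ f = f := by
  refine Scheme.hom_ext_of_forall _ _ fun x => ?_
  obtain ⟨U, w, hx, hw⟩ := exists_conjCoords hp x
  refine ⟨U, hx, ?_⟩
  have h1 : sectionsHom ((U.ι ≫ a) ≫ str) = (sectionsHom (U.ι ≫ str)).comp (ω : S →+* S) := by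
    rw [Category.assoc, ha, ← Category.assoc]
    exact sectionsHom_comp_SpecMap _ _
  have h2 : ConjCoords e str p (U.ι ≫ a) (fun τ => w ((ω : S →ₐ[k] S).comp τ)) := fun τ => by
    have := hw ((ω : S →ₐ[k] S).comp τ)
    rw [h1, Category.assoc, reassoc_of% hap]
    exact this
  have h3 := hf _ _ h2
  rw [h1, Φ.s_comp] at h3
  have h4 := hf _ _ hw
  rw [← Category.assoc]
  refine h3.ext (hasCoords_congr h4 ?_ rfl)
  ext x
  simp

end Conjugates

end

/-! ### The invariant morphism becomes an immersion over `S`. -/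

section

open MvPolynomial

lemma isImmersion_of_forall_exists {X Q : Scheme.{u}} (q : X ⟶ Q)
    (H : ∀ x, ∃ W : Q.Opens, q x ∈ W ∧ ∃ (Z : Scheme.{u}) (z : W.toScheme ⟶ Z),
      IsImmersion ((q ∣_ W) ≫ z)) : IsImmersion q := by
  choose W hW Z z hz using H
  let O : Q.Opens := ⨆ x, W x
  have hO : Set.range q ⊆ Set.range O.ι := by
    rw [Scheme.Opens.range_ι]
    rintro _ ⟨x, rfl⟩
    exact TopologicalSpace.Opens.mem_iSup.2 ⟨x, hW x⟩
  obtain ⟨q', rfl⟩ : ∃ q' : X ⟶ O, q' ≫ O.ι = q := ⟨_, IsOpenImmersion.lift_fac O.ι q hO⟩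
  have : IsImmersion q' := by
    refine IsZariskiLocalAtTarget.of_iSup_eq_top (P := @IsImmersion) (fun x => O.ι ⁻¹ᵁ W x) ?_
      fun x => ?_
    · rw [← top_le_iff]
      intro y _
      obtain ⟨x, hx⟩ := TopologicalSpace.Opens.mem_iSup.1 y.2
      exact TopologicalSpace.Opens.mem_iSup.2 ⟨x, hx⟩
    · have h : IsImmersion ((q' ∣_ O.ι ⁻¹ᵁ W x) ≫ (O.ι ∣_ W x) ≫ z x) := by
        rw [← Category.assoc, ← morphismRestrict_comp]
        exact hz x
      exact IsImmersion.of_comp _ ((O.ι ∣_ W x) ≫ z x)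
  infer_instance

section Conjugates

attribute [local instance] MvPolynomial.gradedAlgebra

variable {k K S : Type u} [Field k] [Field K] [Field S] [Algebra k K] [Algebra k S]
  [FiniteDimensional k K] {n : ℕ} {V X : Scheme.{u}}
  {e : V ⟶ Proj (homogeneousSubmodule (Fin (n + 1)) K)}
  {str : X ⟶ Spec (CommRingCat.of S)} {p : (K →ₐ[k] S) → (X ⟶ V)}
  {Φ : InvariantForms k K S n}

lemma toSpecΓ_SpecMap_sectionsHom_comp {T : Scheme.{u}} (t : T ⟶ Spec (CommRingCat.of S))
    (t' : T ⟶ Spec (CommRingCat.of k)) (h : t' = t ≫ specAlg k S) :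
    T.toSpecΓ ≫ Spec.map (CommRingCat.ofHom ((sectionsHom t).comp (algebraMap k S))) = t' := by
  rw [h, CommRingCat.ofHom_comp, Spec.map_comp, ← Category.assoc, toSpecΓ_SpecMap_sectionsHom]

lemma isImmersion_lift_of_isPullback {P B B' : Scheme.{u}} (e : V ⟶ P) [IsImmersion e] (s : P ⟶ B)
    (b : B' ⟶ B) (g : X ⟶ V) (str : X ⟶ B') (H : IsPullback g str (e ≫ s) b) :
    IsImmersion (pullback.lift (g ≫ e) str (by rw [Category.assoc, H.w]) : X ⟶ pullback s b) := by
  have h1 : IsPullback g (pullback.lift (g ≫ e) str (by rw [Category.assoc, H.w])) e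
      (pullback.fst s b) := by
    refine .of_bot ?_ (pullback.lift_fst _ _ _).symm (IsPullback.of_hasPullback s b)
    rwa [pullback.lift_snd]
  exact MorphismProperty.of_isPullback (P := @IsImmersion) h1 inferInstance

/-- In the chart the `y i` restrict to ratios of forms, so linear combinations `l m` of them give
the products `∏_τ w_{τ,m(τ)}` up to a common unit. Where `l m` is invertible, varying `m` only at
`σ₀` recovers the coordinates of `p σ₀`. Thus `q` composed with a suitable morphism is the immersion
`X → ℙⁿ_K ×_K S`, and `q` is an immersion by cancellation. -/
lemma isImmersion_of_mul_eq {X₁ Q₁ : Scheme.{u}} (h : X₁ ⟶ X) [IsOpenImmersion h] (q : X₁ ⟶ Q₁)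
    (strQ : Q₁ ⟶ Spec (CommRingCat.of S)) (hq : q ≫ strQ = h ≫ str)
    (y : Fin (Φ.N + 1) → Γ(Q₁, ⊤)) (j : Fin (Φ.N + 1))
    (hp : ∀ τ, p τ ≫ e ≫ projStr n K = str ≫ Spec.map (CommRingCat.ofHom (τ : K →+* S)))
    (σ₀ : K →ₐ[k] S)
    (H : IsPullback (p σ₀) str (e ≫ projStr n K) (Spec.map (CommRingCat.ofHom (σ₀ : K →+* S))))
    [IsImmersion e]
    (hy : ∀ {T : Scheme.{u}} (g : T ⟶ X₁) (w : (K →ₐ[k] S) → Fin (n + 1) → Γ(T, ⊤)),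
      ConjCoords e str p (g ≫ h) w → IsUnit (Φ.s (sectionsHom ((g ≫ h) ≫ str)) w j) ∧
        ∀ i, (g ≫ q).appTop.hom (y i) * Φ.s (sectionsHom ((g ≫ h) ≫ str)) w j =
          Φ.s (sectionsHom ((g ≫ h) ≫ str)) w i) : IsImmersion q := by
  classical
  refine isImmersion_of_forall_exists q fun x => ?_
  choose L hL using Φ.exists_sum_eq
  let l : ((K →ₐ[k] S) → Fin (n + 1)) → Γ(Q₁, ⊤) := fun m => ∑ i, sectionsHom strQ (L m i) * y i
  have hl : ∀ {T : Scheme.{u}} (g : T ⟶ X₁) (w : (K →ₐ[k] S) → Fin (n + 1) → Γ(T, ⊤)),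
      ConjCoords e str p (g ≫ h) w → ∀ m, (g ≫ q).appTop.hom (l m) *
        Φ.s (sectionsHom ((g ≫ h) ≫ str)) w j = ∏ τ, w τ (m τ) := by
    intro T g w hw m
    rw [← hL m (sectionsHom ((g ≫ h) ≫ str)) w, map_sum, Finset.sum_mul]
    refine Finset.sum_congr rfl fun i _ => ?_
    rw [map_mul, mul_assoc, (hy g w hw).2, ← RingHom.comp_apply, ← sectionsHom_comp,
      Category.assoc, hq, Category.assoc]
  have hx : ∃ m, q x ∈ Q₁.basicOpen (l m) := by
    obtain ⟨U, w, hxU, hw⟩ := exists_conjCoords hp (h x)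
    let g : (h ⁻¹ᵁ U).toScheme ⟶ U := h ∣_ U
    have hg : g ≫ U.ι = (h ⁻¹ᵁ U).ι ≫ h := morphismRestrict_ι h U
    have hw' := hw.comp g
    rw [hg] at hw'
    let x' : (h ⁻¹ᵁ U).toScheme := ⟨x, hxU⟩
    have h1 : ∀ τ, ∃ j, x' ∈ (h ⁻¹ᵁ U).toScheme.basicOpen (g.appTop.hom (w τ j)) := fun τ => by
      obtain ⟨j, hj⟩ := exists_mem_basicOpen_X ((((h ⁻¹ᵁ U).ι ≫ h) ≫ p τ ≫ e) x')
      exact ⟨j, ((hw' τ).mem_basicOpen_iff j x').2 hj⟩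
    choose m hm using h1
    refine ⟨m, ?_⟩
    have h2 := mem_basicOpen_prod Finset.univ fun τ _ => hm τ
    rw [← hl _ _ hw' m, Scheme.basicOpen_mul] at h2
    have h3 := h2.1
    rw [← Scheme.preimage_basicOpen_top] at h3
    exact h3
  obtain ⟨m, hm⟩ := hx
  let W := Q₁.basicOpen (l m)
  let v : Fin (n + 1) → Γ(W, ⊤) := fun i => W.ι.appTop.hom (l (Function.update m σ₀ i))
  have hv : IsUnit (v (m σ₀)) := by
    simp only [v, Function.update_eq_self]
    exact isUnit_ι_appTop _ le_rfl
  obtain ⟨z, hz⟩ := exists_hasCoords (R := K)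
    ((sectionsHom (W.ι ≫ strQ)).comp (σ₀ : K →+* S)) v
    fun x => ⟨m σ₀, by rw [W.toScheme.basicOpen_of_isUnit hv]; trivial⟩
  have hz' : z ≫ projStr n K = (W.ι ≫ strQ) ≫ Spec.map (CommRingCat.ofHom (σ₀ : K →+* S)) := by
    rw [hz.comp_projStr, CommRingCat.ofHom_comp, Spec.map_comp, ← Category.assoc,
      toSpecΓ_SpecMap_sectionsHom]
  refine ⟨W, hm, _, pullback.lift z (W.ι ≫ strQ) hz', ?_⟩
  have h0 := isImmersion_lift_of_isPullback e _ _ _ _ H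
  have e0 : (q ∣_ W) ≫ pullback.lift z (W.ι ≫ strQ) hz' = ((q ⁻¹ᵁ W).ι ≫ h) ≫
      pullback.lift (p σ₀ ≫ e) str (by rw [Category.assoc, H.w]) := by
    apply pullback.hom_ext
    · rw [Category.assoc, Category.assoc, pullback.lift_fst, pullback.lift_fst]
      refine Scheme.hom_ext_of_forall _ _ fun x' => ?_
      obtain ⟨U, w, hxU, hw⟩ := exists_conjCoords hp (((q ⁻¹ᵁ W).ι ≫ h) x')
      let U' := ((q ⁻¹ᵁ W).ι ≫ h) ⁻¹ᵁ U
      refine ⟨U', hxU, ?_⟩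
      let g : U'.toScheme ⟶ U := ((q ⁻¹ᵁ W).ι ≫ h) ∣_ U
      have hg : g ≫ U.ι = (U'.ι ≫ (q ⁻¹ᵁ W).ι) ≫ h :=
        (morphismRestrict_ι ((q ⁻¹ᵁ W).ι ≫ h) U).trans (Category.assoc _ _ _).symm
      have hw' := hw.comp g
      rw [hg] at hw'
      set w' := fun τ j => g.appTop.hom (w τ j)
      set s := Φ.s (sectionsHom (((U'.ι ≫ (q ⁻¹ᵁ W).ι) ≫ h) ≫ str)) w' j
      have hs : IsUnit s := (hy _ _ hw').1
      -- `D` is the common factor contributed by the embeddings other than `σ₀`; it rescales the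
      -- coordinates of `p σ₀` and is a unit on `U'`.
      let D := ∏ τ ∈ {σ₀}ᶜ, w' τ (m τ)
      have eW : (U'.ι ≫ (q ∣_ W)) ≫ W.ι = (U'.ι ≫ (q ⁻¹ᵁ W).ι) ≫ q := by
        rw [Category.assoc, morphismRestrict_ι, Category.assoc]
      have h1 : ∀ i, s * (U'.ι ≫ (q ∣_ W)).appTop.hom (v i) = D * w' σ₀ i := by
        intro i
        have := hl _ _ hw' (Function.update m σ₀ i)
        rw [Fintype.prod_eq_mul_prod_compl σ₀, Function.update_self, ← eW] at this
        rw [mul_comm, mul_comm D]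
        refine Eq.trans ?_ (this.trans (congrArg _ ?_))
        · rw [Scheme.Hom.comp_appTop (U'.ι ≫ (q ∣_ W))]
          rfl
        · refine Finset.prod_congr rfl fun τ hτ => ?_
          rw [Function.update_of_ne (by simpa using hτ)]
      have hD : IsUnit D := by
        have h2 : IsUnit (D * w' σ₀ (m σ₀)) := by
          rw [← h1]
          exact hs.mul (hv.map _)
        exact isUnit_of_mul_isUnit_left h2
      have h3 := (hz.comp (U'.ι ≫ (q ∣_ W))).mul hs
      have h4 := (hw' σ₀).mul hD
      have h5 : (U'.ι ≫ (q ∣_ W)).appTop.hom.comp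
          ((sectionsHom (W.ι ≫ strQ)).comp (σ₀ : K →+* S)) =
          (sectionsHom (((U'.ι ≫ (q ⁻¹ᵁ W).ι) ≫ h) ≫ str)).comp (σ₀ : K →+* S) := by
        rw [← RingHom.comp_assoc, ← sectionsHom_comp, ← Category.assoc, eW, Category.assoc, hq,
          ← Category.assoc]
      have h6 := (hasCoords_congr h3 h5 (funext h1)).ext h4
      simpa only [Category.assoc] using h6
    · rw [Category.assoc, Category.assoc, pullback.lift_snd, pullback.lift_snd, Category.assoc, ← hq,
        ← Category.assoc, morphismRestrict_ι, Category.assoc]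
  rw [e0]
  infer_instance

lemma IsInvariantMap.isImmersion {f : X ⟶ Proj (homogeneousSubmodule (Fin (Φ.N + 1)) k)}
    (hf : IsInvariantMap e str p Φ f)
    (hp : ∀ τ, p τ ≫ e ≫ projStr n K = str ≫ Spec.map (CommRingCat.ofHom (τ : K →+* S)))
    (σ₀ : K →ₐ[k] S)
    (H : IsPullback (p σ₀) str (e ≫ projStr n K) (Spec.map (CommRingCat.ofHom (σ₀ : K →+* S))))
    [IsImmersion e] :
    IsImmersion (pullback.lift f str (hf.comp_projStr hp) :
      X ⟶ pullback (projStr Φ.N k) (specAlg k S)) := by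
  set q : X ⟶ pullback (projStr Φ.N k) (specAlg k S) := pullback.lift f str (hf.comp_projStr hp)
  let W : Fin (Φ.N + 1) → (pullback (projStr Φ.N k) (specAlg k S)).Opens := fun j =>
    pullback.fst (projStr Φ.N k) (specAlg k S) ⁻¹ᵁ Proj.basicOpen (homogeneousSubmodule (Fin (Φ.N + 1)) k)
      (MvPolynomial.X j)
  have hq1 : q ≫ pullback.fst _ _ = f := pullback.lift_fst _ _ _
  have hq2 : q ≫ pullback.snd _ _ = str := pullback.lift_snd _ _ _
  refine IsZariskiLocalAtTarget.of_iSup_eq_top (P := @IsImmersion) W ?_ fun j => ?_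
  · rw [← top_le_iff]
    intro y _
    obtain ⟨j, hj⟩ := exists_mem_basicOpen_X (pullback.fst (projStr Φ.N k) (specAlg k S) y)
    exact TopologicalSpace.Opens.mem_iSup.2 ⟨j, hj⟩
  · let strQ : (W j).toScheme ⟶ Spec (CommRingCat.of S) := (W j).ι ≫ pullback.snd _ _
    have hr : ((W j).ι ≫ pullback.fst _ _) ≫ projStr Φ.N k = (W j).toScheme.toSpecΓ ≫
        Spec.map (CommRingCat.ofHom ((sectionsHom strQ).comp (algebraMap k S))) :=
      (toSpecΓ_SpecMap_sectionsHom_comp strQ _ (by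
        rw [Category.assoc, pullback.condition, Category.assoc])).symm
    obtain ⟨y, hyj, hy⟩ := exists_hasCoords_of_forall_mem hr (j := j) (fun x => x.2)
    have e1 : (q ∣_ W j) ≫ (W j).ι = (q ⁻¹ᵁ W j).ι ≫ q := morphismRestrict_ι q (W j)
    have e2 : (q ∣_ W j) ≫ strQ = (q ⁻¹ᵁ W j).ι ≫ str := by
      rw [← Category.assoc, e1, Category.assoc, hq2]
    refine isImmersion_of_mul_eq (q ⁻¹ᵁ W j).ι (q ∣_ W j) strQ e2 y j hp σ₀ H
      fun {T} g w hw => ?_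
    have h1 := hf _ _ hw
    have e3 : (g ≫ (q ∣_ W j)) ≫ (W j).ι ≫ pullback.fst _ _ = (g ≫ (q ⁻¹ᵁ W j).ι) ≫ f := by
      rw [Category.assoc, reassoc_of% e1, hq1, Category.assoc]
    have h2 := hy.comp (g ≫ (q ∣_ W j))
    have e4 : (g ≫ (q ∣_ W j)) ≫ strQ = (g ≫ (q ⁻¹ᵁ W j).ι) ≫ str := by
      rw [Category.assoc, e2, Category.assoc]
    rw [e3, ← RingHom.comp_assoc, ← sectionsHom_comp, e4] at h2
    have hu : IsUnit (Φ.s (sectionsHom ((g ≫ (q ⁻¹ᵁ W j).ι) ≫ str)) w j) := by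
      refine isUnit_of_forall_mem_basicOpen fun x => (h1.mem_basicOpen_iff j x).2 ?_
      rw [← e3]
      exact ((g ≫ (q ∣_ W j)) x).2
    refine ⟨hu, fun i => ?_⟩
    have h3 := h2.mul_eq_mul h1 (j := j) (by rw [hyj, map_one]; exact isUnit_one) hu i
    rw [hyj, map_one, mul_one] at h3
    exact h3

end Conjugates

end

/-! ### Descent of a quasi-projective scheme from `S` to `k`. -/

section

section ProjectiveSpace

attribute [local instance] MvPolynomial.gradedAlgebra

open MvPolynomial

lemma isIso_SpecMap_homogeneousSubmodule_zero (n : ℕ) (R : Type u) [CommRing R] :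
    IsIso (Spec.map (CommRingCat.ofHom
      (algebraMap R (homogeneousSubmodule (Fin (n + 1)) R 0)))) := by
  have h : Function.Bijective (algebraMap R (homogeneousSubmodule (Fin (n + 1)) R 0)) := by
    refine ⟨fun a b h => C_injective (Fin (n + 1)) R (congrArg Subtype.val h), fun x => ?_⟩
    have hx : (x : MvPolynomial (Fin (n + 1)) R) ∈ (1 : Submodule R (MvPolynomial _ R)) := by
      rw [← homogeneousSubmodule_zero]; exact x.2
    obtain ⟨r, hr⟩ := Submodule.mem_one.1 hx
    exact ⟨r, Subtype.ext hr⟩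
  have : IsIso (CommRingCat.ofHom (algebraMap R (homogeneousSubmodule (Fin (n + 1)) R 0))) :=
    (RingEquiv.ofBijective _ h).toCommRingCatIso.isIso_hom
  infer_instance

instance (n : ℕ) (R : Type u) [CommRing R] :
    Algebra.FiniteType (homogeneousSubmodule (Fin (n + 1)) R 0) (MvPolynomial (Fin (n + 1)) R) := by
  classical
  refine ⟨⟨Finset.univ.image X, ?_⟩⟩
  rw [Finset.coe_image, Finset.coe_univ, Set.image_univ]
  exact adjoin_range_X_eq_top _ _

instance (n : ℕ) (R : Type u) [CommRing R] : IsSeparated (projStr n R) := by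
  have := isIso_SpecMap_homogeneousSubmodule_zero n R
  have := Proj.isSeparated (homogeneousSubmodule (Fin (n + 1)) R)
  exact MorphismProperty.comp_mem @IsSeparated _ _ this inferInstance

instance (n : ℕ) (R : Type u) [CommRing R] : LocallyOfFiniteType (projStr n R) := by
  have := isIso_SpecMap_homogeneousSubmodule_zero n R
  exact MorphismProperty.comp_mem @LocallyOfFiniteType
    (Proj.toSpecZero (homogeneousSubmodule (Fin (n + 1)) R)) _ inferInstance inferInstance

end ProjectiveSpace

/-- The comparison map `V → V₀ ×_B B'` becomes the identity of `X` after an fpqc base change, and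
isomorphisms descend along such covers. -/
lemma isPullback_of_comp {V₀ V X B B' B'' : Scheme.{u}} {p : X ⟶ V} {c : V ⟶ V₀} {str : X ⟶ B''}
    {v : V ⟶ B'} {v₀ : V₀ ⟶ B} {b : B' ⟶ B} {b' : B'' ⟶ B'} [Surjective b'] [Flat b']
    [QuasiCompact b'] (H : IsPullback p str v b') (H' : IsPullback (p ≫ c) str v₀ (b' ≫ b))
    (hc : c ≫ v₀ = v ≫ b) : IsPullback c v v₀ b := by
  let m : V ⟶ pullback v₀ b := pullback.lift c v hc
  have hm1 : m ≫ pullback.fst _ _ = c := pullback.lift_fst _ _ _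
  have hm2 : m ≫ pullback.snd _ _ = v := pullback.lift_snd _ _ _
  have h1 : IsPullback (p ≫ m) str (pullback.snd v₀ b) b' := by
    refine .of_right ?_ (by rw [Category.assoc, hm2, H.w]) (IsPullback.of_hasPullback v₀ b)
    rwa [Category.assoc, hm1]
  have h2 : IsPullback p (𝟙 X) m (p ≫ m) := by
    refine .of_bot ?_ (Category.id_comp _).symm h1
    rwa [Category.id_comp, hm2]
  have h3 : (@Surjective ⊓ @Flat ⊓ @QuasiCompact : MorphismProperty Scheme.{u}) (p ≫ m) :=
    ⟨⟨MorphismProperty.IsStableUnderBaseChange.of_isPullback (P := @Surjective) h1.flip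
        inferInstance,
      MorphismProperty.IsStableUnderBaseChange.of_isPullback (P := @Flat) h1.flip inferInstance⟩,
      MorphismProperty.IsStableUnderBaseChange.of_isPullback (P := @QuasiCompact) h1.flip
        inferInstance⟩
  have h4 : IsIso m := MorphismProperty.of_isPullback_of_descendsAlong
    (P := MorphismProperty.isomorphisms Scheme.{u}) h2.flip h3
    (inferInstance : IsIso (𝟙 X))
  exact IsPullback.of_iso_pullback ⟨hc⟩ (asIso m) hm1 hm2

lemma exists_algEquiv_comp_eq {k K S : Type u} [Field k] [Field K] [Field S] [Algebra k K]
    [Algebra k S] [Normal k S] (σ τ : K →ₐ[k] S) :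
    ∃ ω : S ≃ₐ[k] S, (ω : S →ₐ[k] S).comp σ = τ := by
  let _ := (σ : K →+* S).toAlgebra
  have : IsScalarTower k K S := .of_algebraMap_eq fun x => (σ.commutes x).symm
  let ω := τ.liftNormal S
  have h : Function.Bijective ω := Algebra.IsAlgebraic.algHom_bijective ω
  exact ⟨AlgEquiv.ofBijective ω h, AlgHom.ext fun x => τ.liftNormal_commutes S x⟩

attribute [local instance] MvPolynomial.gradedAlgebra

variable {k K S : Type u} [Field k] [Field K] [Field S] [Algebra k K] [Algebra k S]

/-- Through `σ`, the field `S` is Galois over `K`; only automorphisms fixing `σ` enter the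
invariance of `p`. -/
lemma exists_fac_of_isPullback [IsGalois k S] {V X Z : Scheme.{u}} {v : V ⟶ Spec (CommRingCat.of K)}
    {str : X ⟶ Spec (CommRingCat.of S)} {p : X ⟶ V} {σ : K →ₐ[k] S}
    (H : IsPullback p str v (Spec.map (CommRingCat.ofHom (σ : K →+* S))))
    {a : (S ≃ₐ[k] S) → (X ⟶ X)} (ha : ∀ ω, a ω ≫ str = str ≫ specAut ω)
    (hp : ∀ ω : S ≃ₐ[k] S, (ω : S →ₐ[k] S).comp σ = σ → a ω ≫ p = p) (f : X ⟶ Z)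
    (hf : ∀ ω, a ω ≫ f = f) : ∃ f' : V ⟶ Z, p ≫ f' = f := by
  let _ := (σ : K →+* S).toAlgebra
  have : IsScalarTower k K S := .of_algebraMap_eq fun x => (σ.commutes x).symm
  have : IsGalois K S := .tower_top_of_isGalois k K S
  exact exists_fac_of_invariant (F := K) (S := S) (a := fun ω => a (ω.restrictScalars k)) H
    (fun ω => ha _) (fun ω => hp _ (AlgHom.ext fun x => ω.commutes x)) f fun ω => hf _

theorem exists_isPullback_of_isQuasiProjective [FiniteDimensional k K] [IsGalois k S]
    {V : SchOver K} (hV : IsQuasiProjective V) {X : Scheme.{u}}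
    {str : X ⟶ Spec (CommRingCat.of S)} {p : (K →ₐ[k] S) → (X ⟶ V.left)}
    (hp : ∀ τ, p τ ≫ V.hom = str ≫ Spec.map (CommRingCat.ofHom (τ : K →+* S)))
    {σ : K →ₐ[k] S}
    (H : IsPullback (p σ) str V.hom (Spec.map (CommRingCat.ofHom (σ : K →+* S))))
    {a : (S ≃ₐ[k] S) → (X ⟶ X)} (hs : ∀ ω, Surjective (a ω))
    (ha : ∀ ω, a ω ≫ str = str ≫ specAut ω)
    (hap : ∀ ω τ, a ω ≫ p τ = p ((ω : S →ₐ[k] S).comp τ)) :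
    ∃ (V₀ : SchOver k) (c : V.left ⟶ V₀.left), IsQuasiProjective V₀ ∧
      IsPullback c V.hom V₀.hom (specAlg k K) ∧ ∀ τ, p τ ≫ c = p σ ≫ c := by
  obtain ⟨hV', n, e', he⟩ := hV
  obtain ⟨Φ⟩ := nonempty_invariantForms k K S n
  obtain ⟨e, he', he⟩ : ∃ e : V.left ⟶ Proj (MvPolynomial.homogeneousSubmodule (Fin (n + 1)) K),
    e ≫ projStr n K = V.hom ∧ IsImmersion e := ⟨e'.left, Over.w e', he⟩
  have hp' : ∀ τ, p τ ≫ e ≫ projStr n K =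
      str ≫ Spec.map (CommRingCat.ofHom (τ : K →+* S)) := fun τ => by
    rw [he', hp]
  obtain ⟨f, hf⟩ := exists_isInvariantMap (Φ := Φ) hp'
  have hfa : ∀ ω, a ω ≫ f = f := fun ω => hf.comp_eq hp' (ha ω) (hap ω)
  have := hf.isImmersion hp' σ (by rwa [he'])
  obtain ⟨Y, t, e₀, hte, he₀, hY⟩ := exists_isPullback_of_isImmersion (hf.comp_projStr hp') ha
    hfa hs
  have hta : ∀ ω, a ω ≫ t = t := fun ω => by
    rw [← cancel_mono e₀, Category.assoc, hte, hfa]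
  obtain ⟨c, hc⟩ := exists_fac_of_isPullback H ha (fun ω hω => by rw [hap, hω]) t hta
  have hb : Spec.map (CommRingCat.ofHom (σ : K →+* S)) ≫ specAlg k K = specAlg k S := by
    rw [← Spec.map_comp, ← CommRingCat.ofHom_comp, σ.comp_algebraMap]
  have hpb : IsPullback c V.hom (e₀ ≫ projStr Φ.N k) (specAlg k K) := by
    let _ := (σ : K →+* S).toAlgebra
    have i1 : Surjective (Spec.map (CommRingCat.ofHom (σ : K →+* S))) :=
      inferInstanceAs (Surjective (specAlg K S))
    have i2 : Flat (Spec.map (CommRingCat.ofHom (σ : K →+* S))) :=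
      inferInstanceAs (Flat (specAlg K S))
    refine isPullback_of_comp H (by rwa [hb, hc]) ?_
    have : Epi (p σ) := by
      have h1 : Surjective (p σ) := MorphismProperty.IsStableUnderBaseChange.of_isPullback
        (P := @Surjective) H.flip inferInstance
      have h2 : Flat (p σ) := MorphismProperty.IsStableUnderBaseChange.of_isPullback
        (P := @Flat) H.flip inferInstance
      exact Flat.epi_of_flat_of_surjective _
    rw [← cancel_epi (p σ), reassoc_of% hc, hY.w, reassoc_of% H.w, hb]
  have hcs : Surjective c := MorphismProperty.IsStableUnderBaseChange.of_isPullback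
        (P := @Surjective) hpb.flip inferInstance
  refine ⟨Over.mk (e₀ ≫ projStr Φ.N k), c, ⟨⟨?_, ?_, ?_⟩, Φ.N, Over.homMk e₀ rfl, he₀⟩, hpb,
    fun τ => ?_⟩
  · exact MorphismProperty.comp_mem @IsSeparated _ _ inferInstance inferInstance
  · exact MorphismProperty.comp_mem @LocallyOfFiniteType _ _ inferInstance inferInstance
  · have := hV'.quasiCompact
    have : CompactSpace V.left := QuasiCompact.compactSpace_of_compactSpace V.hom
    -- Finite type of the descended subscheme needs quasi-compactness, inherited from `V` through
    -- the surjection `c`.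
    have : CompactSpace Y := c.surjective.compactSpace c.continuous
    exact quasiCompact_of_compactSpace (e₀ ≫ projStr Φ.N k)
  -- Every `τ` is `ωσ` for some `ω`, so all `p τ ≫ c` agree with the invariant map `t`.
  · obtain ⟨ω, hω⟩ := exists_algEquiv_comp_eq σ τ
    rw [← hω, ← hap, Category.assoc, hc, hta]

end

/-! ### Descent of quasi-affineness. -/

section

/-- Global sections of a quasi-compact quasi-separated scheme commute with flat affine base change:
`Γ(Y) = Γ(X) ⊗ Γ(T)` over `Γ(S)`. -/
lemma isPullback_toSpecΓ {X Y S T : Scheme.{u}} {f : T ⟶ S} {g : Y ⟶ X} {x : X ⟶ S} {y : Y ⟶ T}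
    (H : IsPullback g y x f) [IsAffine S] [IsAffine T] [Flat f] [CompactSpace X]
    [QuasiSeparatedSpace X] :
    IsPullback g Y.toSpecΓ X.toSpecΓ (Spec.map g.appTop) ∧
      IsPullback (Spec.map g.appTop) (Spec.map y.appTop) (Spec.map x.appTop)
        (Spec.map f.appTop) := by
  have h1 : IsPushout x.appTop f.appTop g.appTop y.appTop := by
    have hT : (⊤ : T.Opens) ≤ f ⁻¹ᵁ (⊤ : S.Opens) := le_top
    have hX : (⊤ : X.Opens) ≤ x ⁻¹ᵁ (⊤ : S.Opens) := le_top
    have := (isIso_pushoutSection_iff H (UY := ⊤) hT hX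
      (by simp)).1 (isIso_pushoutSection_of_isQuasiSeparated_of_flat_right H hT hX _
        (isAffineOpen_top S) (isAffineOpen_top T) CompactSpace.isCompact_univ
        ((isQuasiSeparated_univ_iff).2 inferInstance))
    have e : ∀ {A B : Scheme.{u}} (h : A ⟶ B) (l), h.appLE ⊤ ⊤ l = h.appTop :=
      fun h _ => Scheme.Hom.appLE_eq_app h
    simpa only [e] using this
  have h2 : IsPullback (Spec.map g.appTop) (Spec.map y.appTop) (Spec.map x.appTop)
      (Spec.map f.appTop) := (h1.op.map Scheme.Spec).flip
  refine ⟨.of_bot ?_ (Scheme.toSpecΓ_naturality g) h2, h2⟩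
  rw [← Scheme.toSpecΓ_naturality, ← Scheme.toSpecΓ_naturality]
  exact H.paste_vert (IsPullback.of_vert_isIso ⟨Scheme.toSpecΓ_naturality f⟩)

/-- `Y → Spec Γ(Y)` is the fpqc base change of `X → Spec Γ(X)`, and open immersions descend. -/
lemma isQuasiAffine_of_isPullback {X Y S T : Scheme.{u}} {f : T ⟶ S} {g : Y ⟶ X} {x : X ⟶ S}
    {y : Y ⟶ T} (H : IsPullback g y x f) [IsAffine S] [IsAffine T] [Flat f] [Surjective f]
    [QuasiSeparatedSpace X] [CompactSpace X] [Y.IsQuasiAffine] : X.IsQuasiAffine := by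
  obtain ⟨h1, h2⟩ := isPullback_toSpecΓ H
  have hf : Spec.map f.appTop = inv T.toSpecΓ ≫ f ≫ S.toSpecΓ := by
    rw [Scheme.toSpecΓ_naturality, IsIso.inv_hom_id_assoc]
  have hs : Surjective (Spec.map f.appTop) := hf ▸ inferInstance
  have hfl : Flat (Spec.map f.appTop) := hf ▸ inferInstance
  have h3 : (@Surjective ⊓ @Flat ⊓ @QuasiCompact : MorphismProperty Scheme.{u})
      (Spec.map g.appTop) :=
    ⟨⟨MorphismProperty.IsStableUnderBaseChange.of_isPullback (P := @Surjective) h2.flip hs,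
      MorphismProperty.IsStableUnderBaseChange.of_isPullback (P := @Flat) h2.flip hfl⟩,
      inferInstanceAs (QuasiCompact (Spec.map g.appTop))⟩
  have h4 : IsOpenImmersion X.toSpecΓ := MorphismProperty.of_isPullback_of_descendsAlong
    (P := @IsOpenImmersion) h1.flip h3 inferInstance
  exact {}

end

/-! ### Iterated base change of fields and its faithfulness. -/

section

lemma IsPullback.epi_of_field {F L : Type u} [Field F] [Field L] {i : F →+* L} {X Y : Scheme.{u}}
    {g : X ⟶ Y} {x : X ⟶ Spec (CommRingCat.of L)} {y : Y ⟶ Spec (CommRingCat.of F)}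
    (H : IsPullback g x y (Spec.map (CommRingCat.ofHom i))) : Epi g := by
  let _ := i.toAlgebra
  have h1 : Surjective g := MorphismProperty.IsStableUnderBaseChange.of_isPullback
    (P := @Surjective) H.flip (inferInstanceAs (Surjective (specAlg F L)))
  have h2 : Flat g := MorphismProperty.IsStableUnderBaseChange.of_isPullback
    (P := @Flat) H.flip (inferInstanceAs (Flat (specAlg F L)))
  exact Flat.epi_of_flat_of_surjective g

section BaseChange

variable {F L M M' : Type u} [Field F] [Field L] [Field M] [Field M']

/-- The projection `iV ⟶ V`. -/
def baseChangeFst (i : F →+* L) (V : SchOver F) : ((baseChange i).obj V).left ⟶ V.left :=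
  pullback.fst V.hom (Spec.map (CommRingCat.ofHom i))

lemma isPullback_baseChangeFst (i : F →+* L) (V : SchOver F) :
    IsPullback (baseChangeFst i V) ((baseChange i).obj V).hom V.hom
      (Spec.map (CommRingCat.ofHom i)) :=
  IsPullback.of_hasPullback _ _

lemma baseChange_map_left_fst (i : F →+* L) {V V' : SchOver F} (g : V ⟶ V') :
    ((baseChange i).map g).left ≫ baseChangeFst i V' = baseChangeFst i V ≫ g.left :=
  pullback.lift_fst _ _ _

/-- The projection `(j ∘ i)V ⟶ iV`. -/
def transFst (i : F →+* L) (j : L →+* M) (l : F →+* M) (h : l = j.comp i) (V : SchOver F) :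
    ((baseChange l).obj V).left ⟶ ((baseChange i).obj V).left :=
  (baseChangeComp i j l h V).hom.left ≫ baseChangeFst j ((baseChange i).obj V)

variable {i : F →+* L} {j : L →+* M} {l : F →+* M} (h : l = j.comp i) (V : SchOver F)

lemma transFst_baseChangeFst : transFst i j l h V ≫ baseChangeFst i V = baseChangeFst l V := by
  refine (Category.assoc _ _ _).trans ?_
  refine (pullback.lift_fst_assoc _ _ _ _).trans ?_
  exact pullback.lift_fst _ _ _

lemma transFst_hom : transFst i j l h V ≫ ((baseChange i).obj V).hom =
    ((baseChange l).obj V).hom ≫ Spec.map (CommRingCat.ofHom j) := by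
  refine (Category.assoc _ _ _).trans ?_
  rw [(isPullback_baseChangeFst j ((baseChange i).obj V)).w, ← Category.assoc,
    Over.w (baseChangeComp i j l h V).hom]

lemma isPullback_transFst : IsPullback (transFst i j l h V) ((baseChange l).obj V).hom
    ((baseChange i).obj V).hom (Spec.map (CommRingCat.ofHom j)) := by
  refine .of_right ?_ (transFst_hom h V) (isPullback_baseChangeFst i V)
  rw [transFst_baseChangeFst, ← Spec.map_comp, ← CommRingCat.ofHom_comp, ← h]
  exact isPullback_baseChangeFst l V

instance : Epi (transFst i j l h V) := IsPullback.epi_of_field (isPullback_transFst h V)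

instance : Epi (baseChangeFst i V) := IsPullback.epi_of_field (isPullback_baseChangeFst i V)

lemma transFst_transFst {j' : M →+* M'} {m : F →+* M'} (h' : m = j'.comp l)
    (h'' : m = (j'.comp j).comp i) :
    transFst l j' m h' V ≫ transFst i j l h V = transFst i (j'.comp j) m h'' V := by
  apply (isPullback_baseChangeFst i V).hom_ext
  · rw [Category.assoc, transFst_baseChangeFst, transFst_baseChangeFst, transFst_baseChangeFst]
  · rw [Category.assoc, transFst_hom, ← Category.assoc, transFst_hom, transFst_hom,
      Category.assoc, ← Spec.map_comp, CommRingCat.ofHom_comp]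

variable {V} {i' : F →+* L} {l' : F →+* M} (h' : l' = j.comp i')

lemma baseChange_iso_ext {V' : SchOver F} {W : SchOver L} {Ψ Ψ' : W ≅ (baseChange i).obj V'}
    (H : Ψ.hom.left ≫ baseChangeFst i V' = Ψ'.hom.left ≫ baseChangeFst i V') : Ψ = Ψ' := by
  ext1
  apply Over.OverMorphism.ext
  apply (isPullback_baseChangeFst i V').hom_ext H
  rw [Over.w, Over.w]

lemma conjIso_hom_left_transFst (ψ : (baseChange i).obj V ≅ (baseChange i').obj V) :
    (conjIso j ψ l l' h h').hom.left ≫ transFst i' j l' h' V =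
      transFst i j l h V ≫ ψ.hom.left := by
  have h1 : (baseChangeComp i' j l' h' V).inv.left ≫ (baseChangeComp i' j l' h' V).hom.left =
      𝟙 _ := by
    rw [← Over.comp_left, Iso.inv_hom_id, Over.id_left]
  have h2 : (conjIso j ψ l l' h h').hom.left = (baseChangeComp i j l h V).hom.left ≫
      ((baseChange j).map ψ.hom).left ≫ (baseChangeComp i' j l' h' V).inv.left := rfl
  rw [h2, transFst, Category.assoc, Category.assoc, reassoc_of% h1, baseChange_map_left_fst,
    transFst, Category.assoc]

/-- Compatibility with the projections to the smaller field characterizes the base-changed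
isomorphism, replacing calculations with the canonical identifications. -/
lemma eq_conjIso {ψ : (baseChange i).obj V ≅ (baseChange i').obj V}
    {Ψ : (baseChange l).obj V ≅ (baseChange l').obj V}
    (H : Ψ.hom.left ≫ transFst i' j l' h' V = transFst i j l h V ≫ ψ.hom.left) :
    Ψ = conjIso j ψ l l' h h' := by
  apply baseChange_iso_ext
  have H' := conjIso_hom_left_transFst h h' ψ
  rw [← transFst_baseChangeFst h', reassoc_of% H, reassoc_of% H']

/-- The projection is an epimorphism, so base change of fields is faithful; identities between
isomorphisms over `Ω` can therefore be brought down. -/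
lemma conjIso_injective {ψ ψ' : (baseChange i).obj V ≅ (baseChange i').obj V}
    (H : conjIso j ψ l l' h h' = conjIso j ψ' l l' h h') : ψ = ψ' := by
  ext1
  apply Over.OverMorphism.ext
  rw [← cancel_epi (transFst i j l h V), ← conjIso_hom_left_transFst h h', H,
    conjIso_hom_left_transFst]

lemma conjIso_trans {i'' : F →+* L} {l'' : F →+* M} (h'' : l'' = j.comp i'')
    (ψ : (baseChange i).obj V ≅ (baseChange i').obj V)
    (ψ' : (baseChange i').obj V ≅ (baseChange i'').obj V) :
    conjIso j (ψ ≪≫ ψ') l l'' h h'' = conjIso j ψ l l' h h' ≪≫ conjIso j ψ' l' l'' h' h'' := by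
  refine (eq_conjIso h h'' ?_).symm
  rw [Iso.trans_hom, Over.comp_left, Category.assoc, conjIso_hom_left_transFst, ← Category.assoc,
    conjIso_hom_left_transFst, Iso.trans_hom, Over.comp_left, Category.assoc]

lemma conjIso_conjIso {j' : M →+* M'} {m m' : F →+* M'} (hm : m = j'.comp l)
    (hm' : m' = j'.comp l') {j'' : L →+* M'} (hj : j'' = j'.comp j)
    (ψ : (baseChange i).obj V ≅ (baseChange i').obj V) :
    conjIso j' (conjIso j ψ l l' h h') m m' hm hm' =
      conjIso j'' ψ m m' (by rw [hm, h, hj, RingHom.comp_assoc])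
        (by rw [hm', h', hj, RingHom.comp_assoc]) := by
  subst hj
  apply eq_conjIso
  rw [← transFst_transFst h' V hm', ← Category.assoc, conjIso_hom_left_transFst, Category.assoc,
    conjIso_hom_left_transFst, ← Category.assoc, transFst_transFst]

end BaseChange

/-! ### Models as cartesian projections `V → V₀`. -/

section Model

variable {k K L M : Type u} [Field k] [Field K] [Field L] [Field M] [Algebra k K]
  {V : SchOver K} {V₀ : SchOver k} {c : V.left ⟶ V₀.left}
  (H : IsPullback c V.hom V₀.hom (specAlg k K))

include H in
lemma isPullback_baseChangeFst_comp (l : K →+* L) :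
    IsPullback (baseChangeFst l V ≫ c) ((baseChange l).obj V).hom V₀.hom
      (Spec.map (CommRingCat.ofHom (l.comp (algebraMap k K)))) := by
  rw [CommRingCat.ofHom_comp, Spec.map_comp]
  exact (isPullback_baseChangeFst l V).paste_horiz H

/-- The isomorphism `σV ≅ τV` given by a model of `V` over `k`. -/
def modelIso (σ τ : K →+* L) (h : σ.comp (algebraMap k K) = τ.comp (algebraMap k K)) :
    (baseChange σ).obj V ≅ (baseChange τ).obj V :=
  Over.isoMk ((isPullback_baseChangeFst_comp H σ).isoIsPullback _ _
    (h ▸ isPullback_baseChangeFst_comp H τ)) (IsPullback.isoIsPullback_hom_snd ..)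

lemma modelIso_hom_left {σ τ : K →+* L} (h : σ.comp (algebraMap k K) = τ.comp (algebraMap k K)) :
    (modelIso H σ τ h).hom.left ≫ baseChangeFst τ V ≫ c = baseChangeFst σ V ≫ c :=
  IsPullback.isoIsPullback_hom_fst ..

/-- Both `σV` and `τV` are the base change of `V₀` along the same map, so compatibility with the
projections to `V₀` pins down the isomorphism. -/
lemma eq_modelIso {σ τ : K →+* L} (h : σ.comp (algebraMap k K) = τ.comp (algebraMap k K))
    {ψ : (baseChange σ).obj V ≅ (baseChange τ).obj V}
    (hψ : ψ.hom.left ≫ baseChangeFst τ V ≫ c = baseChangeFst σ V ≫ c) : ψ = modelIso H σ τ h := by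
  ext1
  apply Over.OverMorphism.ext
  apply (isPullback_baseChangeFst_comp H τ).hom_ext
  · rw [hψ, modelIso_hom_left]
  · rw [Over.w, Over.w]

lemma modelIso_trans {ρ σ τ : K →+* L} (h : ρ.comp (algebraMap k K) = σ.comp (algebraMap k K))
    (h' : σ.comp (algebraMap k K) = τ.comp (algebraMap k K)) :
    modelIso H ρ τ (h.trans h') = modelIso H ρ σ h ≪≫ modelIso H σ τ h' := by
  refine (eq_modelIso H _ ?_).symm
  rw [Iso.trans_hom, Over.comp_left, Category.assoc, modelIso_hom_left, modelIso_hom_left]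

lemma conjIso_modelIso {σ τ : K →+* L} (h : σ.comp (algebraMap k K) = τ.comp (algebraMap k K))
    {j : L →+* M} {l l' : K →+* M} (hl : l = j.comp σ) (hl' : l' = j.comp τ)
    (h' : l.comp (algebraMap k K) = l'.comp (algebraMap k K)) :
    conjIso j (modelIso H σ τ h) l l' hl hl' = modelIso H l l' h' := by
  apply eq_modelIso
  rw [← transFst_baseChangeFst hl', Category.assoc, ← Category.assoc, conjIso_hom_left_transFst,
    Category.assoc, modelIso_hom_left, ← Category.assoc, transFst_baseChangeFst]

variable (V V₀) in
/-- The projection of `V` to a model `V₀` over `k`. -/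
def modelProj (f : (baseChange (algebraMap k K)).obj V₀ ≅ V) : V.left ⟶ V₀.left :=
  f.inv.left ≫ baseChangeFst (algebraMap k K) V₀

lemma isPullback_modelProj (f : (baseChange (algebraMap k K)).obj V₀ ≅ V) :
    IsPullback (modelProj V V₀ f) V.hom V₀.hom (specAlg k K) := by
  refine .of_iso (isPullback_baseChangeFst (algebraMap k K) V₀) ((Over.forget _).mapIso f)
    (Iso.refl _) (Iso.refl _) (Iso.refl _) ?_ ?_ ?_ ?_
  · have : f.hom.left ≫ f.inv.left = 𝟙 _ := by
      rw [← Over.comp_left, Iso.hom_inv_id, Over.id_left]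
    simp [modelProj, reassoc_of% this]
  · simp
  · simp
  · simp

end Model

end

/-! ### Descent data over `Ω` and over the separable closure. -/

section

variable {k K Ω : Type u} [Field k] [Field K] [Field Ω] [Algebra k K] [Algebra k Ω]
  {V : SchOver K} {φ : ∀ τ σ : K →ₐ[k] Ω, twist σ V ≅ twist τ V}

lemma comp_algebraMap_eq {S : Type*} [Field S] [Algebra k S] (σ τ : K →ₐ[k] S) :
    (σ : K →+* S).comp (algebraMap k K) = (τ : K →+* S).comp (algebraMap k K) := by
  rw [σ.comp_algebraMap, τ.comp_algebraMap]

/-- Rewrites the formula for a model in terms of the projection `V → V₀` alone; all later arguments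
use this form. -/
lemma model_eq_modelIso {V₀ : SchOver k} (f : (baseChange (algebraMap k K)).obj V₀ ≅ V)
    (σ τ : K →ₐ[k] Ω) :
    ((baseChange (σ : K →+* Ω)).mapIso f).symm ≪≫ (twistBaseChange σ V₀).symm ≪≫
      twistBaseChange τ V₀ ≪≫ (baseChange (τ : K →+* Ω)).mapIso f =
    modelIso (isPullback_modelProj f) (σ : K →+* Ω) (τ : K →+* Ω) (comp_algebraMap_eq σ τ) := by
  apply eq_modelIso
  have h1 : f.hom.left ≫ f.inv.left = 𝟙 _ := by
    rw [← Over.comp_left, Iso.hom_inv_id, Over.id_left]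
  have key : ∀ τ : K →ₐ[k] Ω, ((baseChange (τ : K →+* Ω)).map f.hom).left ≫
      baseChangeFst (τ : K →+* Ω) V ≫ modelProj V V₀ f =
      baseChangeFst (τ : K →+* Ω) _ ≫ baseChangeFst (algebraMap k K) V₀ := fun τ => by
    rw [← Category.assoc, baseChange_map_left_fst, modelProj, Category.assoc, reassoc_of% h1]
  have key2 : ∀ τ : K →ₐ[k] Ω, (twistBaseChange τ V₀).hom.left ≫
      baseChangeFst (τ : K →+* Ω) _ ≫ baseChangeFst (algebraMap k K) V₀ =
      baseChangeFst (algebraMap k Ω) V₀ := fun τ => by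
    rw [← Category.assoc]
    exact transFst_baseChangeFst τ.comp_algebraMap.symm V₀
  have h2 : ((baseChange (σ : K →+* Ω)).map f.inv).left ≫
      ((baseChange (σ : K →+* Ω)).map f.hom).left = 𝟙 _ := by
    rw [← Over.comp_left, ← CategoryTheory.Functor.map_comp, Iso.inv_hom_id,
      CategoryTheory.Functor.map_id, Over.id_left]
  have h3 : (twistBaseChange σ V₀).inv.left ≫ (twistBaseChange σ V₀).hom.left = 𝟙 _ := by
    rw [← Over.comp_left, Iso.inv_hom_id, Over.id_left]
  simp only [Iso.trans_hom, Iso.symm_hom, Functor.mapIso_inv, Functor.mapIso_hom, Over.comp_left,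
    Category.assoc]
  rw [key, key2, ← key2 σ, reassoc_of% h3, ← key σ, reassoc_of% h2]

lemma IsModel.eq_modelIso {V₀ : SchOver k} {f : (baseChange (algebraMap k K)).obj V₀ ≅ V}
    (h : IsModel φ V₀ f) (τ σ : K →ₐ[k] Ω) : φ τ σ =
      modelIso (isPullback_modelProj f) (σ : K →+* Ω) (τ : K →+* Ω) (comp_algebraMap_eq σ τ) :=
  (h.eq τ σ).trans (model_eq_modelIso f σ τ)

lemma algEquiv_comp_eq {S : Type*} [Field S] [Algebra k S] (ω : S ≃ₐ[k] S) (σ : K →ₐ[k] S) :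
    (((ω : S →ₐ[k] S).comp σ : K →ₐ[k] S) : K →+* S) = (ω : S →+* S).comp (σ : K →+* S) := rfl

/-- The embedding into `Ω` given by an embedding into the separable closure of `k` in `Ω`. -/
abbrev ofSep (σ : K →ₐ[k] separableClosure k Ω) : K →ₐ[k] Ω :=
  (separableClosure k Ω).val.comp σ

lemma ofSep_eq (σ : K →ₐ[k] separableClosure k Ω) : (ofSep σ : K →+* Ω) =
    (algebraMap (separableClosure k Ω) Ω).comp (σ : K →+* separableClosure k Ω) := rfl

variable [Algebra.IsSeparable k K]

variable (φ) in
/-- The conditions on the family `φ` for descent. -/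
structure IsDescentDatum : Prop where
  isDefinedOverSep : ∀ τ σ : K →ₐ[k] Ω, IsDefinedOverSep (φ τ σ)
  trans : ∀ ρ σ τ : K →ₐ[k] Ω, φ τ ρ = φ σ ρ ≪≫ φ τ σ
  isGalConj : ∀ (σ τ : K →ₐ[k] Ω) (ω : algebraicClosure k Ω ≃ₐ[k] algebraicClosure k Ω),
        IsGalConj ω (φ τ σ) (φ (galAct ω τ) (galAct ω σ))

lemma IsModel.isDescentDatum {V₀ : SchOver k} {f : (baseChange (algebraMap k K)).obj V₀ ≅ V}
    (h : IsModel φ V₀ f) : IsDescentDatum φ where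
  isDefinedOverSep τ σ := ⟨modelIso (isPullback_modelProj f) _ _ (comp_algebraMap_eq _ _),
    (h.eq_modelIso τ σ).trans (conjIso_modelIso _ _ _ _ _).symm⟩
  trans ρ σ τ := by
    rw [h.eq_modelIso, h.eq_modelIso, h.eq_modelIso, ← modelIso_trans]
  isGalConj σ τ ω := ⟨modelIso (isPullback_modelProj f) _ _ (comp_algebraMap_eq _ _),
    (h.eq_modelIso τ σ).trans (conjIso_modelIso _ _ _ _ _).symm,
    (h.eq_modelIso _ _).trans ((conjIso_modelIso _ _ _ _ _).symm.trans
      (conjIso_conjIso _ _ _ _ rfl _).symm)⟩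

/-- The descent of a descent datum to the separable closure. -/
def IsDescentDatum.sepIso (h : IsDescentDatum φ) (τ σ : K →ₐ[k] separableClosure k Ω) :
    (baseChange (σ : K →+* separableClosure k Ω)).obj V ≅
      (baseChange (τ : K →+* separableClosure k Ω)).obj V :=
  (h.isDefinedOverSep (ofSep τ) (ofSep σ)).choose

lemma IsDescentDatum.conjIso_sepIso (h : IsDescentDatum φ) (τ σ : K →ₐ[k] separableClosure k Ω) :
    φ (ofSep τ) (ofSep σ) = conjIso (algebraMap (separableClosure k Ω) Ω) (h.sepIso τ σ)
      (ofSep σ) (ofSep τ) (ofSep_eq σ) (ofSep_eq τ) :=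
  (h.isDefinedOverSep (ofSep τ) (ofSep σ)).choose_spec

lemma IsDescentDatum.sepIso_trans (h : IsDescentDatum φ)
    (ρ σ τ : K →ₐ[k] separableClosure k Ω) :
    h.sepIso τ ρ = h.sepIso σ ρ ≪≫ h.sepIso τ σ := by
  apply conjIso_injective (j := algebraMap (separableClosure k Ω) Ω) (l := ofSep ρ)
    (l' := ofSep τ) (ofSep_eq ρ) (ofSep_eq τ)
  rw [conjIso_trans (ofSep_eq ρ) (ofSep_eq σ) (ofSep_eq τ), ← h.conjIso_sepIso,
    ← h.conjIso_sepIso, ← h.conjIso_sepIso, h.trans]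

/-- Bridges the condition on automorphisms of the algebraic closure and descent over the separable
closure; the extension exists by normality. -/
lemma exists_algEquiv_algebraicClosure [IsAlgClosed Ω]
    (ω : separableClosure k Ω ≃ₐ[k] separableClosure k Ω) :
    ∃ ω' : algebraicClosure k Ω ≃ₐ[k] algebraicClosure k Ω,
      ∀ (x : separableClosure k Ω) (hx : (x : Ω) ∈ algebraicClosure k Ω), (ω' ⟨x, hx⟩ : Ω) = ω x := by
  let ι : separableClosure k Ω →ₐ[k] algebraicClosure k Ω :=
    IntermediateField.inclusion (le_algebraicClosure k Ω (separableClosure k Ω))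
  let _ := (ι : separableClosure k Ω →+* algebraicClosure k Ω).toAlgebra
  have : IsScalarTower k (separableClosure k Ω) (algebraicClosure k Ω) :=
    .of_algebraMap_eq fun x => (ι.commutes x).symm
  have : IsAlgClosure k (algebraicClosure k Ω) := inferInstance
  have : Normal k (algebraicClosure k Ω) := IsAlgClosure.normal k _
  exact ⟨ω.liftNormal _, fun x hx => congrArg Subtype.val (ω.liftNormal_commutes _ x)⟩

lemma IsDescentDatum.sepIso_galois [IsAlgClosed Ω] (h : IsDescentDatum φ)
    (σ τ : K →ₐ[k] separableClosure k Ω) (ω : separableClosure k Ω ≃ₐ[k] separableClosure k Ω) :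
    h.sepIso ((ω : separableClosure k Ω →ₐ[k] separableClosure k Ω).comp τ)
      ((ω : separableClosure k Ω →ₐ[k] separableClosure k Ω).comp σ) =
      conjIso (ω : separableClosure k Ω →+* separableClosure k Ω) (h.sepIso τ σ) _ _
        (algEquiv_comp_eq ω σ) (algEquiv_comp_eq ω τ) := by
  obtain ⟨ω', hω'⟩ := exists_algEquiv_algebraicClosure ω
  have hg : ∀ τ : K →ₐ[k] separableClosure k Ω, galAct ω' (ofSep τ) =
      ofSep ((ω : separableClosure k Ω →ₐ[k] separableClosure k Ω).comp τ) := fun τ =>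
    AlgHom.ext fun x => hω' (τ x) _
  obtain ⟨ψ, hψ, hψ'⟩ := h.isGalConj (ofSep σ) (ofSep τ) ω'
  -- The conjugated embeddings equal those in `hg` only propositionally and occur in the type of
  -- `φ`; generalizing them allows substitution.
  have key : ∀ (σ₁ τ₁ : K →ₐ[k] Ω) (h₁ : galAct ω' (ofSep σ) = σ₁) (h₂ : galAct ω' (ofSep τ) = τ₁),
      φ τ₁ σ₁ = conjIso (algebraMap (algebraicClosure k Ω) Ω)
        (conjIso (ω' : algebraicClosure k Ω →+* algebraicClosure k Ω) ψ _ _ rfl rfl)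
        σ₁ τ₁ (by rw [← h₁]; rfl) (by rw [← h₂]; rfl) := by
    rintro _ _ rfl rfl
    exact hψ'
  let ι : separableClosure k Ω →+* algebraicClosure k Ω :=
    IntermediateField.inclusion (le_algebraicClosure k Ω (separableClosure k Ω))
  have hι : ∀ τ : K →ₐ[k] separableClosure k Ω, (toAl (ofSep τ) : K →+* algebraicClosure k Ω) =
      ι.comp (τ : K →+* separableClosure k Ω) := fun _ => rfl
  have hj : algebraMap (separableClosure k Ω) Ω = (algebraMap (algebraicClosure k Ω) Ω).comp ι :=
    rfl
  have hal : ∀ τ : K →ₐ[k] separableClosure k Ω, (ofSep τ : K →+* Ω) =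
      (algebraMap (algebraicClosure k Ω) Ω).comp
        (toAl (ofSep τ) : K →+* algebraicClosure k Ω) := fun _ => rfl
  -- The descent to the algebraic closure supplied by Galois conjugation is unspecified, but by
  -- faithfulness it must come from `h.sepIso τ σ`.
  have h1 : ψ = conjIso ι (h.sepIso τ σ) _ _ (hι σ) (hι τ) := by
    apply conjIso_injective (hal σ) (hal τ)
    rw [conjIso_conjIso (hι σ) (hι τ) (hal σ) (hal τ) hj]
    exact hψ.symm.trans (h.conjIso_sepIso τ σ)
  apply conjIso_injective (j := algebraMap (separableClosure k Ω) Ω) (ofSep_eq _) (ofSep_eq _)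
  refine (h.conjIso_sepIso _ _).symm.trans ((key _ _ (hg σ) (hg τ)).trans ?_)
  rw [h1]
  have hc : ((algebraMap (algebraicClosure k Ω) Ω).comp
      (ω' : algebraicClosure k Ω →+* algebraicClosure k Ω)).comp ι =
      (algebraMap (separableClosure k Ω) Ω).comp
        (ω : separableClosure k Ω →+* separableClosure k Ω) :=
    RingHom.ext fun x => hω' x _
  refine (conjIso_conjIso _ _ _ _ rfl _).trans ?_
  refine (conjIso_conjIso _ _ _ _ hc.symm _).trans ?_
  exact (conjIso_conjIso _ _ _ _ rfl _).symm

end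

/-! ### Existence, uniqueness and properties of the model. -/

section

variable {k K Ω : Type u} [Field k] [Field K] [Field Ω] [Algebra k K] [Algebra k Ω]
  {V : SchOver K} {φ : ∀ τ σ : K →ₐ[k] Ω, twist σ V ≅ twist τ V}

lemma exists_iso_modelProj_eq {V₀ : SchOver k} {c : V.left ⟶ V₀.left}
    (H : IsPullback c V.hom V₀.hom (specAlg k K)) :
    ∃ f : (baseChange (algebraMap k K)).obj V₀ ≅ V, modelProj V V₀ f = c :=
  ⟨Over.isoMk (H.isoIsPullback _ _ (isPullback_baseChangeFst (algebraMap k K) V₀)).symm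
    (IsPullback.isoIsPullback_inv_snd ..), IsPullback.isoIsPullback_hom_fst ..⟩

lemma baseChange_mapIso_trans_eq_iff {V₀ V₀' : SchOver k}
    (f : (baseChange (algebraMap k K)).obj V₀ ≅ V) (f' : (baseChange (algebraMap k K)).obj V₀' ≅ V)
    (α : V₀ ≅ V₀') : (baseChange (algebraMap k K)).mapIso α ≪≫ f' = f ↔
      modelProj V V₀ f ≫ α.hom.left = modelProj V V₀' f' := by
  constructor
  · rintro rfl
    have h1 : ((baseChange (algebraMap k K)).mapIso α ≪≫ f').inv.left =
        f'.inv.left ≫ ((baseChange (algebraMap k K)).map α.inv).left := rfl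
    have h2 := baseChange_map_left_fst (algebraMap k K) α.inv
    have h3 : α.inv.left ≫ α.hom.left = 𝟙 _ := by
      rw [← Over.comp_left, Iso.inv_hom_id, Over.id_left]
    rw [modelProj, h1, Category.assoc, Category.assoc, reassoc_of% h2, h3, Category.comp_id,
      modelProj]
  · intro H
    have h1 : f.hom.left ≫ f.inv.left = 𝟙 _ := by
      rw [← Over.comp_left, Iso.hom_inv_id, Over.id_left]
    suffices (baseChange (algebraMap k K)).mapIso α = f ≪≫ f'.symm by
      rw [this, Iso.trans_assoc, Iso.symm_self_id, Iso.trans_refl]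
    apply baseChange_iso_ext
    rw [Functor.mapIso_hom, baseChange_map_left_fst, Iso.trans_hom, Iso.symm_hom, Over.comp_left,
      Category.assoc]
    rw [modelProj, modelProj, Category.assoc] at H
    rw [← H, reassoc_of% h1]

lemma isIso_hom_left {B : Scheme.{u}} {X Y : Over B} (ψ : X ≅ Y) : IsIso ψ.hom.left :=
  inferInstanceAs (IsIso ((Over.forget B).map ψ.hom))

lemma isPullback_iso_baseChangeFst {F L : Type u} [Field F] [Field L] {i : F →+* L}
    {V : SchOver F} {W : SchOver L} (ψ : W ≅ (baseChange i).obj V) :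
    IsPullback (ψ.hom.left ≫ baseChangeFst i V) W.hom V.hom (Spec.map (CommRingCat.ofHom i)) := by
  have := isIso_hom_left ψ
  have h1 : IsPullback ψ.hom.left W.hom ((baseChange i).obj V).hom (𝟙 _) :=
    .of_horiz_isIso ⟨by rw [Over.w, Category.comp_id]⟩
  simpa only [Category.id_comp] using h1.paste_horiz (isPullback_baseChangeFst i V)

section Galois

variable {S : Type u} [Field S] [Algebra k S]

/-- The semilinear action on `σV` of an automorphism `ω` of the field, given an isomorphism of
`(ωσ)V` with `σV`. -/
def semilinear (σ : K →ₐ[k] S) (ω : S ≃ₐ[k] S)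
    (ψ : (baseChange (σ : K →+* S)).obj V ≅
      (baseChange (((ω : S →ₐ[k] S).comp σ : K →ₐ[k] S) : K →+* S)).obj V) :
    ((baseChange (σ : K →+* S)).obj V).left ⟶ ((baseChange (σ : K →+* S)).obj V).left :=
  ψ.hom.left ≫ transFst (σ : K →+* S) (ω : S →+* S) _ (algEquiv_comp_eq ω σ) V

variable {σ : K →ₐ[k] S} {ω : S ≃ₐ[k] S} (ψ : (baseChange (σ : K →+* S)).obj V ≅
      (baseChange (((ω : S →ₐ[k] S).comp σ : K →ₐ[k] S) : K →+* S)).obj V)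

lemma semilinear_hom : semilinear σ ω ψ ≫ ((baseChange (σ : K →+* S)).obj V).hom =
    ((baseChange (σ : K →+* S)).obj V).hom ≫ specAut ω := by
  rw [semilinear, Category.assoc, transFst_hom, ← Category.assoc, Over.w]

instance : Surjective (semilinear σ ω ψ) := by
  have : IsIso (Spec.map (CommRingCat.ofHom (ω : S →+* S))) := by
    have : IsIso (CommRingCat.ofHom (ω : S →+* S)) :=
      (ω.toRingEquiv.toCommRingCatIso).isIso_hom
    infer_instance
  have : IsIso (transFst (σ : K →+* S) (ω : S →+* S) _ (algEquiv_comp_eq ω σ) V) :=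
    (isPullback_transFst (algEquiv_comp_eq ω σ) V).isIso_fst_of_isIso
  have := isIso_hom_left ψ
  rw [semilinear]
  infer_instance

end Galois

theorem IsModel.isQuasiAffine {V₀ : SchOver k}
    {f : (baseChange (algebraMap k K)).obj V₀ ≅ V} (h : IsModel φ V₀ f)
    [V.left.IsQuasiAffine] : V₀.left.IsQuasiAffine := by
  have := h.isAlgebraic.quasiCompact
  have := h.isAlgebraic.isSeparated
  have : CompactSpace V₀.left := QuasiCompact.compactSpace_of_compactSpace V₀.hom
  have : QuasiSeparatedSpace V₀.left := quasiSeparatedSpace_of_quasiSeparated V₀.hom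
  exact isQuasiAffine_of_isPullback (isPullback_modelProj f)

variable [Algebra.IsSeparable k K] [IsAlgClosed Ω]

variable (k K Ω) in
lemma nonempty_algHom_separableClosure : Nonempty (K →ₐ[k] separableClosure k Ω) :=
  ⟨toSep (IsAlgClosed.lift : K →ₐ[k] Ω)⟩

instance : IsGalois k (separableClosure k Ω) := by
  have := IsSepClosed.of_isAlgClosed Ω
  infer_instance

theorem IsDescentDatum.exists_isModel [FiniteDimensional k K] (h : IsDescentDatum φ) (hV : IsQuasiProjective V) :
    ∃ (V₀ : SchOver k) (f : (baseChange (algebraMap k K)).obj V₀ ≅ V),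
      IsQuasiProjective V₀ ∧ IsModel φ V₀ f := by
  obtain ⟨σ₀⟩ := nonempty_algHom_separableClosure k K Ω
  let p (τ : K →ₐ[k] separableClosure k Ω) :=
    (h.sepIso τ σ₀).hom.left ≫ baseChangeFst (τ : K →+* separableClosure k Ω) V
  let a (ω : separableClosure k Ω ≃ₐ[k] separableClosure k Ω) :=
    semilinear σ₀ ω (h.sepIso _ σ₀)
  obtain ⟨V₀, c, hV₀, H, hc⟩ := exists_isPullback_of_isQuasiProjective (k := k) (K := K)
    (S := separableClosure k Ω) hV (str := ((baseChange _).obj V).hom) (p := p)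
    (fun τ => by
      rw [Category.assoc, (isPullback_baseChangeFst _ V).w, ← Category.assoc, Over.w])
    (σ := σ₀) (isPullback_iso_baseChangeFst (h.sepIso σ₀ σ₀))
    (a := a) (fun ω => inferInstanceAs (Surjective (semilinear _ _ _)))
    (fun ω => semilinear_hom _) (fun ω τ => by
      simp only [a, semilinear, p]
      -- The cocycle condition splits the isomorphism `σ₀V → (ωτ)V` at `(ωσ₀)V`; the second factor
      -- is the `ω`-conjugate of `σ₀V → τV`, which commutes with the projections. This gives `a ω ≫
      -- p τ = p (ωτ)`.
      rw [h.sepIso_trans σ₀ ((ω : separableClosure k Ω →ₐ[k] _).comp σ₀)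
        ((ω : separableClosure k Ω →ₐ[k] _).comp τ), h.sepIso_galois,
        Iso.trans_hom, Over.comp_left, ← transFst_baseChangeFst (algEquiv_comp_eq ω τ)]
      have := conjIso_hom_left_transFst (algEquiv_comp_eq ω σ₀) (algEquiv_comp_eq ω τ)
        (h.sepIso τ σ₀)
      simp only [Category.assoc]
      rw [reassoc_of% this])
  obtain ⟨f, rfl⟩ := exists_iso_modelProj_eq H
  refine ⟨V₀, f, hV₀, hV₀.1, fun τ σ => ?_⟩
  rw [model_eq_modelIso]
  refine (h.conjIso_sepIso (toSep τ) (toSep σ)).trans ?_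
  rw [eq_modelIso (isPullback_modelProj f) (comp_algebraMap_eq (toSep σ) (toSep τ)) (ψ :=
    h.sepIso (toSep τ) (toSep σ)), conjIso_modelIso]
  · rfl
  -- The equality of all `p τ ≫ c` says that the isomorphisms out of `σ₀V` respect the projections
  -- to `V₀`; by the cocycle condition so do those between any two conjugates.
  · have e1 := hc (toSep τ)
    have e2 := hc (toSep σ)
    have := isIso_hom_left (h.sepIso (toSep σ) σ₀)
    rw [← cancel_epi (h.sepIso (toSep σ) σ₀).hom.left]
    simp only [p, Category.assoc] at e1 e2
    rw [← Category.assoc, ← Over.comp_left, ← Iso.trans_hom, ← h.sepIso_trans, e1, e2]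

/-- Both models induce the same isomorphisms over `S`, hence the same semilinear action on `σ₀V`.
The projection to `V₀'` is thus invariant for the action defining `V₀` and factors through it. -/
lemma IsModel.exists_modelProj_fac {V₀ V₀' : SchOver k}
    {f : (baseChange (algebraMap k K)).obj V₀ ≅ V} {f' : (baseChange (algebraMap k K)).obj V₀' ≅ V}
    (h : IsModel φ V₀ f) (h' : IsModel φ V₀' f') :
    ∃ α : V₀.left ⟶ V₀'.left, modelProj V V₀ f ≫ α = modelProj V V₀' f' := by
  obtain ⟨σ₀⟩ := nonempty_algHom_separableClosure k K Ω
  have heq : ∀ τ : K →ₐ[k] separableClosure k Ω,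
      modelIso (isPullback_modelProj f) _ _ (comp_algebraMap_eq σ₀ τ) =
        modelIso (isPullback_modelProj f') _ _ (comp_algebraMap_eq σ₀ τ) := fun τ => by
    apply conjIso_injective (ofSep_eq σ₀) (ofSep_eq τ)
    rw [conjIso_modelIso (h' := comp_algebraMap_eq (ofSep σ₀) (ofSep τ)),
      conjIso_modelIso (h' := comp_algebraMap_eq (ofSep σ₀) (ofSep τ)), ← h.eq_modelIso,
      ← h'.eq_modelIso]
  have H := isPullback_baseChangeFst_comp (isPullback_modelProj f)
    (σ₀ : K →+* separableClosure k Ω)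
  rw [σ₀.comp_algebraMap] at H
  obtain ⟨α, hα⟩ := exists_fac_of_invariant
    (a := fun ω => semilinear σ₀ ω
      (modelIso (isPullback_modelProj f) _ _ (comp_algebraMap_eq σ₀ _)))
    H (fun ω => semilinear_hom _) (fun ω => by
      rw [semilinear, Category.assoc, ← Category.assoc (transFst _ _ _ _ _),
        transFst_baseChangeFst, modelIso_hom_left])
    (baseChangeFst (σ₀ : K →+* separableClosure k Ω) V ≫ modelProj V V₀' f') (fun ω => by
      rw [heq, semilinear, Category.assoc, ← Category.assoc (transFst _ _ _ _ _),
        transFst_baseChangeFst, modelIso_hom_left])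
  refine ⟨α, ?_⟩
  rwa [Category.assoc, cancel_epi] at hα

theorem IsModel.existsUnique_iso {V₀ V₀' : SchOver k}
    {f : (baseChange (algebraMap k K)).obj V₀ ≅ V} {f' : (baseChange (algebraMap k K)).obj V₀' ≅ V}
    (h : IsModel φ V₀ f) (h' : IsModel φ V₀' f') :
    ∃! α : V₀ ≅ V₀', (baseChange (algebraMap k K)).mapIso α ≪≫ f' = f := by
  obtain ⟨α, hα⟩ := h.exists_modelProj_fac h'
  obtain ⟨β, hβ⟩ := h'.exists_modelProj_fac h
  have e : Epi (modelProj V V₀ f) := IsPullback.epi_of_field (isPullback_modelProj f)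
  have e' : Epi (modelProj V V₀' f') := IsPullback.epi_of_field (isPullback_modelProj f')
  have hαβ : α ≫ β = 𝟙 _ := by
    rw [← cancel_epi (modelProj V V₀ f), reassoc_of% hα, hβ, Category.comp_id]
  have hβα : β ≫ α = 𝟙 _ := by
    rw [← cancel_epi (modelProj V V₀' f'), reassoc_of% hβ, hα, Category.comp_id]
  have hw : α ≫ V₀'.hom = V₀.hom := by
    rw [← cancel_epi (modelProj V V₀ f), reassoc_of% hα, (isPullback_modelProj f').w,
      (isPullback_modelProj f).w]
  refine ⟨Over.isoMk ⟨α, β, hαβ, hβα⟩ hw, ?_, fun α' hα' => ?_⟩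
  · exact (baseChange_mapIso_trans_eq_iff _ _ _).2 hα
  · replace hα' := (baseChange_mapIso_trans_eq_iff _ _ _).1 hα'
    ext1
    apply Over.OverMorphism.ext
    rw [← cancel_epi (modelProj V V₀ f), hα']
    exact hα.symm

/-- A model is only assumed algebraic; uniqueness identifies it with the one built inside projective
space. -/
theorem IsModel.isQuasiProjective [FiniteDimensional k K] {V₀ : SchOver k}
    {f : (baseChange (algebraMap k K)).obj V₀ ≅ V} (h : IsModel φ V₀ f)
    (hV : IsQuasiProjective V) : IsQuasiProjective V₀ := by
  obtain ⟨V₁, f₁, ⟨-, n, e, he⟩, h₁⟩ := h.isDescentDatum.exists_isModel hV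
  obtain ⟨α, -, -⟩ := h.existsUnique_iso h₁
  have := isIso_hom_left α
  refine ⟨h.isAlgebraic, n, α.hom ≫ e, ?_⟩
  rw [Over.comp_left]
  infer_instance

end

end WeilDescent

end

theorem theorem11p1 {k K Ω : Type u} [Field k] [Field K] [Field Ω] [Algebra k K] [Algebra k Ω]
    [IsAlgClosed Ω] [FiniteDimensional k K] [Algebra.IsSeparable k K]
    (V : SchOver K) (hV : IsQuasiProjective V)
    (φ : ∀ τ σ : K →ₐ[k] Ω, twist σ V ≅ twist τ V) :
    ((∃ (V₀ : SchOver k) (f : (baseChange (algebraMap k K)).obj V₀ ≅ V), IsModel φ V₀ f) ↔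
      (∀ τ σ : K →ₐ[k] Ω, IsDefinedOverSep (φ τ σ)) ∧
      (∀ ρ σ τ : K →ₐ[k] Ω, φ τ ρ = φ σ ρ ≪≫ φ τ σ) ∧
      (∀ (σ τ : K →ₐ[k] Ω) (ω : algebraicClosure k Ω ≃ₐ[k] algebraicClosure k Ω),
        IsGalConj ω (φ τ σ) (φ (galAct ω τ) (galAct ω σ)))) ∧
    (∀ (V₀ V₀' : SchOver k) (f : (baseChange (algebraMap k K)).obj V₀ ≅ V)
      (f' : (baseChange (algebraMap k K)).obj V₀' ≅ V), IsModel φ V₀ f → IsModel φ V₀' f' →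
      ∃! α : V₀ ≅ V₀', (baseChange (algebraMap k K)).mapIso α ≪≫ f' = f) ∧
    (∀ (V₀ : SchOver k) (f : (baseChange (algebraMap k K)).obj V₀ ≅ V), IsModel φ V₀ f →
      IsQuasiProjective V₀ ∧ (V.left.IsQuasiAffine → V₀.left.IsQuasiAffine)) := by
  refine ⟨⟨fun ⟨V₀, f, h⟩ => ?_, fun ⟨h₁, h₂, h₃⟩ => ?_⟩,
    fun V₀ V₀' f f' h h' => h.existsUnique_iso h',
    fun V₀ f h => ⟨h.isQuasiProjective hV, fun _ => h.isQuasiAffine⟩⟩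
  · exact ⟨h.isDescentDatum.isDefinedOverSep, h.isDescentDatum.trans, h.isDescentDatum.isGalConj⟩
  · obtain ⟨V₀, f, -, h⟩ := IsDescentDatum.exists_isModel ⟨h₁, h₂, h₃⟩ hV
    exact ⟨V₀, f, h⟩
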